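/- Work in two-sorted first-order logic with number variables $x,y,z,\dots$ and string (finite-set) variables $X,Y,Z,\dots$. The base vocabulary is $\mathcal L^2_A=[0,1,+,\cdot,|\ |;\in,\le,=^1,=^2]$, and we write $X(t)$ for $t\in X$. Every vocabulary considered extends $\mathcal L^2_A$ by number functions, string functions and relations. For a vocabulary $\mathcal L$, a $\Sigma^B_0(\mathcal L)$ formula has no string quantifiers and only bounded number quantifiers; a $g\Sigma^B_1(\mathcal L)$ formula is built from $\Sigma^B_0(\mathcal L)$ formulas by $\wedge$, $\vee$, bounded number quantifiers and bounded existential string quantifiers $\exists X\le t$ (meaning $\exists X(|X|\le t\wedge\cdots)$); all bounding terms are terms of $\mathcal L^2_A$. "Open" means quantifier-free, and an open theory is one axiomatized by universal closures of open formulas. For an open formula $\alpha(z,\vec x,\vec X)$ and an $\mathcal L^2_A$-term $t(\vec x,\vec X)$, the string function $F_{\alpha,t}$ has the defining axiom $$F_{\alpha,t}(\vec x,\vec X)(z)\leftrightarrow z<t\wedge\alpha(z,\vec x,\vec X),$$ and the number function $f_{\alpha,t}$ has the defining axioms $$f_{\alpha,t}(\vec x,\vec X)\le t,\qquad f_{\alpha,t}(\vec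 x,\vec X)<t\supset\alpha(f_{\alpha,t}(\vec x,\vec X),\vec x,\vec X),\qquad z<f_{\alpha,t}(\vec x,\vec X)\supset\neg\alpha(z,\vec x,\vec X).$$ $\mathcal L_{FAC^0}$ is the smallest vocabulary that contains $\mathcal L^2_A$, the predecessor function $pd$ and the function $f_{SE}$, and that contains $F_{\alpha,t}$ and $f_{\alpha,t}$ for all its open formulas $\alpha$ and all $\mathcal L^2_A$-terms $t$. $\overline{V}^0$ is the universal theory over $\mathcal L_{FAC^0}$ whose axioms are the universal closures of: $x+1\ne0$; $x+1=y+1\supset x=y$; $x+0=x$; $x+(y+1)=(x+y)+1$; $x\cdot0=0$; $x\cdot(y+1)=(x\cdot y)+x$; $(x\le y\wedge y\le x)\supset x=y$; $0\le x$; $(x\le y\wedge y\le z)\supset x\le z$; $x\le y\vee y\le x$; $x\le y\leftrightarrow x<y+1$; $pd(0)=0$; $x\ne0\supset pd(x)+1=x$; $X(y)\supset y<|X|$; $y+1=|X|\supset X(y)$; $X=Y\supset(|X|=|Y|\wedge(z<|X|\supset(X(z)\leftrightarrow Y(z))))$; $(|X|=|Y|\wedge f_{SE}(X,Y)=|X|)\supset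 X=Y$; the axioms saying that $f_{SE}(X,Y)$ is $f_{\alpha,t}(X,Y)$ for $\alpha\equiv\neg(X(z)\leftrightarrow Y(z))$ and $t=|X|$; and the defining axioms of all the $F_{\alpha,t}$ and $f_{\alpha,t}$. Here $s<t$ abbreviates $s\le t\wedge s\neq t$. **General Witnessing Theorem.** Let $\mathcal L$ be a vocabulary that extends $\mathcal L_{FAC^0}$ and has functions $F_{\alpha,t}$ and $f_{\alpha,t}$ for every open formula $\alpha$ of $\mathcal L$ and every term $t$ of $\mathcal L^2_A$. Let $\mathcal T$ be an open theory over $\mathcal L$ that extends $\overline{V}^0$ and contains the defining axioms of all these functions $F_{\alpha,t}$, $f_{\alpha,t}$. Let $\varphi(\vec x,\vec X,\vec Z)$ be a $g\Sigma^B_1(\mathcal L)$ formula such that $\mathcal T\vdash\exists\vec Z\,\varphi(\vec x,\vec X,\vec Z)$. Then: 1. there are functions $\vec F$, each given by a string term of $\mathcal L$ in the variables $\vec x,\vec X$, such that $$\mathcal T\vdash\forall\vec x\,\forall\vec X\ \varphi(\vec x,\vec X,\vec F(\vec x,\vec X));$$ 2. if moreover the functions of $\mathcal L$ are polynomially bounded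 in $\mathcal T$ (that is, for each number function $f$ and each string function $F$ of $\mathcal L$ there is an $\mathcal L^2_A$-term $p(\vec x,\vec X)$ with $\mathcal T\vdash f(\vec x,\vec X)<p(\vec x,\vec X)$, respectively $\mathcal T\vdash|F(\vec x,\vec X)|<p(\vec x,\vec X)$), then the $\vec F$ can be taken to be string function symbols of $\mathcal L$. -/

import Mathlib

universe u v w

namespace TwoSorted

/-! ## Syntax of two-sorted logic

Every vocabulary extends `[0, 1, +, ·, | |; ∈, ≤, =¹, =²]`, so these symbols are built into the
syntax, and a vocabulary only lists its remaining function and relation symbols.  Terms and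
formulas are well-scoped: `n` counts the free number variables and `m` the free string variables,
and a quantifier binds the last variable of its sort. -/

/-- The two sorts: numbers, and strings (finite sets of numbers). -/
inductive Srt : Type
  | num
  | str

/-- The number terms of the base vocabulary `[0, 1, +, ·, | |; ∈, ≤, =¹, =²]`, whose only string
terms are the string variables.  They serve as bounding terms. -/
inductive BTm (n m : ℕ) : Type
  | var (i : Fin n) : BTm n m
  | zero : BTm n m
  | one : BTm n m
  | add (s t : BTm n m) : BTm n m
  | mul (s t : BTm n m) : BTm n m
  | len (i : Fin m) : BTm n m

/-- Terms of sort `s`.  `Fn .num k l` are the number function symbols and `Fn .str k l` the string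
function symbols with `k` number arguments and `l` string arguments. -/
inductive Tm (Fn : Srt → ℕ → ℕ → Type u) : Srt → ℕ → ℕ → Type u
  | nvar {n m : ℕ} (i : Fin n) : Tm Fn .num n m
  | svar {n m : ℕ} (i : Fin m) : Tm Fn .str n m
  | zero {n m : ℕ} : Tm Fn .num n m
  | one {n m : ℕ} : Tm Fn .num n m
  | add {n m : ℕ} (s t : Tm Fn .num n m) : Tm Fn .num n m
  | mul {n m : ℕ} (s t : Tm Fn .num n m) : Tm Fn .num n m
  | len {n m : ℕ} (S : Tm Fn .str n m) : Tm Fn .num n m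
  | fn {c : Srt} {n m k l : ℕ} (f : Fn c k l) (s : Fin k → Tm Fn .num n m)
      (S : Fin l → Tm Fn .str n m) : Tm Fn c n m

/-- `qf` marks the open (quantifier-free) formulas, `full` the arbitrary formulas. -/
inductive Kind : Type
  | qf
  | full

/-- Formulas; those of kind `qf` are the open formulas. -/
inductive Fm (Fn : Srt → ℕ → ℕ → Type u) (R : ℕ → ℕ → Type u) : Kind → ℕ → ℕ → Type u
  | tru {κ : Kind} {n m : ℕ} : Fm Fn R κ n m
  | fls {κ : Kind} {n m : ℕ} : Fm Fn R κ n m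
  | eqN {κ : Kind} {n m : ℕ} (s t : Tm Fn .num n m) : Fm Fn R κ n m
  | eqS {κ : Kind} {n m : ℕ} (S T : Tm Fn .str n m) : Fm Fn R κ n m
  | le {κ : Kind} {n m : ℕ} (s t : Tm Fn .num n m) : Fm Fn R κ n m
  | mem {κ : Kind} {n m : ℕ} (t : Tm Fn .num n m) (S : Tm Fn .str n m) : Fm Fn R κ n m
  | rel {κ : Kind} {n m k l : ℕ} (r : R k l) (s : Fin k → Tm Fn .num n m)
      (S : Fin l → Tm Fn .str n m) : Fm Fn R κ n m
  | neg {κ : Kind} {n m : ℕ} (φ : Fm Fn R κ n m) : Fm Fn R κ n m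
  | and {κ : Kind} {n m : ℕ} (φ ψ : Fm Fn R κ n m) : Fm Fn R κ n m
  | or {κ : Kind} {n m : ℕ} (φ ψ : Fm Fn R κ n m) : Fm Fn R κ n m
  | exN {n m : ℕ} (φ : Fm Fn R .full (n + 1) m) : Fm Fn R .full n m
  | allN {n m : ℕ} (φ : Fm Fn R .full (n + 1) m) : Fm Fn R .full n m
  | exS {n m : ℕ} (φ : Fm Fn R .full n (m + 1)) : Fm Fn R .full n m
  | allS {n m : ℕ} (φ : Fm Fn R .full n (m + 1)) : Fm Fn R .full n m

section Formulas

variable {Fn : Srt → ℕ → ℕ → Type u} {R : ℕ → ℕ → Type u}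

/-- A base term as a term of a larger vocabulary. -/
def BTm.toTm {n m : ℕ} : BTm n m → Tm Fn .num n m
  | .var i => .nvar i
  | .zero => .zero
  | .one => .one
  | .add s t => .add s.toTm t.toTm
  | .mul s t => .mul s.toTm t.toTm
  | .len i => .len (.svar i)

/-- Simultaneous substitution in terms. -/
def Tm.subst {n' m' : ℕ} : {c : Srt} → {n m : ℕ} → Tm Fn c n m →
    (Fin n → Tm Fn .num n' m') → (Fin m → Tm Fn .str n' m') → Tm Fn c n' m'
  | _, _, _, .nvar i, σ, _ => σ i
  | _, _, _, .svar i, _, τ => τ i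
  | _, _, _, .zero, _, _ => .zero
  | _, _, _, .one, _, _ => .one
  | _, _, _, .add s t, σ, τ => .add (s.subst σ τ) (t.subst σ τ)
  | _, _, _, .mul s t, σ, τ => .mul (s.subst σ τ) (t.subst σ τ)
  | _, _, _, .len S, σ, τ => .len (S.subst σ τ)
  | _, _, _, .fn f s S, σ, τ => .fn f (fun i => (s i).subst σ τ) (fun j => (S j).subst σ τ)

/-- A term regarded in the scope of one more number variable. -/
def Tm.liftN {c : Srt} {n m : ℕ} (t : Tm Fn c n m) : Tm Fn c (n + 1) m :=
  t.subst (fun i => .nvar i.castSucc) (fun j => .svar j)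

/-- A term regarded in the scope of one more string variable. -/
def Tm.liftS {c : Srt} {n m : ℕ} (t : Tm Fn c n m) : Tm Fn c n (m + 1) :=
  t.subst (fun i => .nvar i) (fun j => .svar j.castSucc)

/-- Simultaneous capture-avoiding substitution in formulas. -/
def Fm.subst : {κ : Kind} → {n m : ℕ} → Fm Fn R κ n m → {n' m' : ℕ} →
    (Fin n → Tm Fn .num n' m') → (Fin m → Tm Fn .str n' m') → Fm Fn R κ n' m'
  | _, _, _, .tru, _, _, _, _ => .tru
  | _, _, _, .fls, _, _, _, _ => .fls
  | _, _, _, .eqN s t, _, _, σ, τ => .eqN (s.subst σ τ) (t.subst σ τ)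
  | _, _, _, .eqS S T, _, _, σ, τ => .eqS (S.subst σ τ) (T.subst σ τ)
  | _, _, _, .le s t, _, _, σ, τ => .le (s.subst σ τ) (t.subst σ τ)
  | _, _, _, .mem t S, _, _, σ, τ => .mem (t.subst σ τ) (S.subst σ τ)
  | _, _, _, .rel r s S, _, _, σ, τ =>
      .rel r (fun i => (s i).subst σ τ) (fun j => (S j).subst σ τ)
  | _, _, _, .neg φ, _, _, σ, τ => .neg (φ.subst σ τ)
  | _, _, _, .and φ ψ, _, _, σ, τ => .and (φ.subst σ τ) (ψ.subst σ τ)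
  | _, _, _, .or φ ψ, _, _, σ, τ => .or (φ.subst σ τ) (ψ.subst σ τ)
  | _, _, _, .exN φ, n', _, σ, τ =>
      .exN (φ.subst (Fin.snoc (fun i => (σ i).liftN) (.nvar (Fin.last n')))
        (fun j => (τ j).liftN))
  | _, _, _, .allN φ, n', _, σ, τ =>
      .allN (φ.subst (Fin.snoc (fun i => (σ i).liftN) (.nvar (Fin.last n')))
        (fun j => (τ j).liftN))
  | _, _, _, .exS φ, _, m', σ, τ =>
      .exS (φ.subst (fun i => (σ i).liftS)
        (Fin.snoc (fun j => (τ j).liftS) (.svar (Fin.last m'))))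
  | _, _, _, .allS φ, _, m', σ, τ =>
      .allS (φ.subst (fun i => (σ i).liftS)
        (Fin.snoc (fun j => (τ j).liftS) (.svar (Fin.last m'))))

/-- An open formula regarded as a formula. -/
def Fm.toFull : {κ : Kind} → {n m : ℕ} → Fm Fn R κ n m → Fm Fn R .full n m
  | _, _, _, .tru => .tru
  | _, _, _, .fls => .fls
  | _, _, _, .eqN s t => .eqN s t
  | _, _, _, .eqS S T => .eqS S T
  | _, _, _, .le s t => .le s t
  | _, _, _, .mem t S => .mem t S
  | _, _, _, .rel r s S => .rel r s S
  | _, _, _, .neg φ => .neg φ.toFull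
  | _, _, _, .and φ ψ => .and φ.toFull ψ.toFull
  | _, _, _, .or φ ψ => .or φ.toFull ψ.toFull
  | _, _, _, .exN φ => .exN φ
  | _, _, _, .allN φ => .allN φ
  | _, _, _, .exS φ => .exS φ
  | _, _, _, .allS φ => .allS φ

/-- Implication `φ ⊃ ψ`. -/
def Fm.imp {κ : Kind} {n m : ℕ} (φ ψ : Fm Fn R κ n m) : Fm Fn R κ n m := .or (.neg φ) ψ

/-- Equivalence `φ ↔ ψ`. -/
def Fm.iff {κ : Kind} {n m : ℕ} (φ ψ : Fm Fn R κ n m) : Fm Fn R κ n m :=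
  .and (φ.imp ψ) (ψ.imp φ)

/-- `s < t` abbreviates `s ≤ t ∧ s ≠ t`. -/
def Fm.lt {κ : Kind} {n m : ℕ} (s t : Tm Fn .num n m) : Fm Fn R κ n m :=
  .and (.le s t) (.neg (.eqN s t))

/-- The bounded number quantifier `∃ x ≤ t, φ`; the bound is a base term without `x`. -/
def Fm.bexN {n m : ℕ} (t : BTm n m) (φ : Fm Fn R .full (n + 1) m) : Fm Fn R .full n m :=
  .exN (.and (.le (.nvar (Fin.last n)) t.toTm.liftN) φ)

/-- The bounded number quantifier `∀ x ≤ t, φ`. -/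
def Fm.ballN {n m : ℕ} (t : BTm n m) (φ : Fm Fn R .full (n + 1) m) : Fm Fn R .full n m :=
  .allN (.imp (.le (.nvar (Fin.last n)) t.toTm.liftN) φ)

/-- The bounded string quantifier `∃ X ≤ t, φ`, that is `∃ X (|X| ≤ t ∧ φ)`. -/
def Fm.bexS {n m : ℕ} (t : BTm n m) (φ : Fm Fn R .full n (m + 1)) : Fm Fn R .full n m :=
  .exS (.and (.le (.len (.svar (Fin.last m))) t.toTm.liftS) φ)

/-- The unbounded block `∃ Z₁ ⋯ ∃ Z_p, φ`, binding the last `p` string variables. -/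
def Fm.exSs {n m : ℕ} : (p : ℕ) → Fm Fn R .full n (m + p) → Fm Fn R .full n m
  | 0, φ => φ
  | p + 1, φ => Fm.exSs p (.exS φ)

/-- `Σ^B_0` formulas: no string quantifiers, and all number quantifiers are bounded. -/
inductive IsSigma0B : {n m : ℕ} → Fm Fn R .full n m → Prop
  | qf {n m : ℕ} (α : Fm Fn R .qf n m) : IsSigma0B α.toFull
  | neg {n m : ℕ} {φ : Fm Fn R .full n m} : IsSigma0B φ → IsSigma0B (.neg φ)
  | and {n m : ℕ} {φ ψ : Fm Fn R .full n m} : IsSigma0B φ → IsSigma0B ψ → IsSigma0B (.and φ ψ)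
  | or {n m : ℕ} {φ ψ : Fm Fn R .full n m} : IsSigma0B φ → IsSigma0B ψ → IsSigma0B (.or φ ψ)
  | bexN {n m : ℕ} (t : BTm n m) {φ : Fm Fn R .full (n + 1) m} :
      IsSigma0B φ → IsSigma0B (.bexN t φ)
  | ballN {n m : ℕ} (t : BTm n m) {φ : Fm Fn R .full (n + 1) m} :
      IsSigma0B φ → IsSigma0B (.ballN t φ)

/-- `gΣ^B_1` formulas: obtained from `Σ^B_0` formulas by `∧`, `∨`, bounded number quantifiers and
bounded existential string quantifiers. -/
inductive IsGSigma1B : {n m : ℕ} → Fm Fn R .full n m → Prop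
  | base {n m : ℕ} {φ : Fm Fn R .full n m} : IsSigma0B φ → IsGSigma1B φ
  | and {n m : ℕ} {φ ψ : Fm Fn R .full n m} :
      IsGSigma1B φ → IsGSigma1B ψ → IsGSigma1B (.and φ ψ)
  | or {n m : ℕ} {φ ψ : Fm Fn R .full n m} :
      IsGSigma1B φ → IsGSigma1B ψ → IsGSigma1B (.or φ ψ)
  | bexN {n m : ℕ} (t : BTm n m) {φ : Fm Fn R .full (n + 1) m} :
      IsGSigma1B φ → IsGSigma1B (.bexN t φ)
  | ballN {n m : ℕ} (t : BTm n m) {φ : Fm Fn R .full (n + 1) m} :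
      IsGSigma1B φ → IsGSigma1B (.ballN t φ)
  | bexS {n m : ℕ} (t : BTm n m) {φ : Fm Fn R .full n (m + 1)} :
      IsGSigma1B φ → IsGSigma1B (.bexS t φ)

/-- The term `f(x⃗, X⃗)`: a function symbol applied to all the variables in scope. -/
def appVars {c : Srt} {k l : ℕ} (f : Fn c k l) : Tm Fn c k l :=
  .fn f (fun i => .nvar i) (fun j => .svar j)

/-- The defining axiom `F(x⃗, X⃗)(z) ↔ z < t(x⃗, X⃗) ∧ α(z, x⃗, X⃗)` of `F = F_{α,t}`; here and below
`z` is the last number variable of `α`. -/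
def compAx {k l : ℕ} (F : Fn .str k l) (α : Fm Fn R .qf (k + 1) l) (t : BTm k l) :
    Fm Fn R .qf (k + 1) l :=
  .iff (.mem (.nvar (Fin.last k)) (appVars F).liftN)
    (.and (.lt (.nvar (Fin.last k)) t.toTm.liftN) α)

/-- First defining axiom of `f = f_{α,t}`: `f(x⃗, X⃗) ≤ t(x⃗, X⃗)`. -/
def minAx1 {k l : ℕ} (f : Fn .num k l) (t : BTm k l) : Fm Fn R .qf k l :=
  .le (appVars f) t.toTm

/-- Second defining axiom of `f = f_{α,t}`:
`f(x⃗, X⃗) < t(x⃗, X⃗) ⊃ α(f(x⃗, X⃗), x⃗, X⃗)`. -/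
def minAx2 {k l : ℕ} (f : Fn .num k l) (α : Fm Fn R .qf (k + 1) l) (t : BTm k l) :
    Fm Fn R .qf k l :=
  .imp (.lt (appVars f) t.toTm)
    (α.subst (Fin.snoc (fun i => .nvar i) (appVars f)) (fun j => .svar j))

/-- Third defining axiom of `f = f_{α,t}`: `z < f(x⃗, X⃗) ⊃ ¬ α(z, x⃗, X⃗)`. -/
def minAx3 {k l : ℕ} (f : Fn .num k l) (α : Fm Fn R .qf (k + 1) l) :
    Fm Fn R .qf (k + 1) l :=
  .imp (.lt (.nvar (Fin.last k)) (appVars f).liftN) (.neg α)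

end Formulas

/-! ## Vocabularies, structures, theories -/

/-- A vocabulary extending `[0, 1, +, ·, | |; ∈, ≤, =¹, =²]`, given by its further function symbols
(of each sort) and relation symbols, with their arities. -/
structure Vocab : Type (u + 1) where
  /-- Function symbols with value sort, number arity and string arity. -/
  Fn : Srt → ℕ → ℕ → Type u
  /-- Relation symbols with number arity and string arity. -/
  Rel : ℕ → ℕ → Type u

/-- Terms of a vocabulary. -/
abbrev Vocab.Term (L : Vocab.{u}) (c : Srt) (n m : ℕ) : Type u := Tm L.Fn c n m

/-- Open formulas of a vocabulary. -/
abbrev Vocab.Open (L : Vocab.{u}) (n m : ℕ) : Type u := Fm L.Fn L.Rel .qf n m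

/-- Formulas of a vocabulary. -/
abbrev Vocab.Formula (L : Vocab.{u}) (n m : ℕ) : Type u := Fm L.Fn L.Rel .full n m

/-- A two-sorted structure: two nonempty domains and interpretations of all symbols.  Both
equality symbols are interpreted as true equality. -/
structure Struc (L : Vocab.{u}) : Type (max u (v + 1)) where
  /-- `Dom .num` is the number domain and `Dom .str` the string domain. -/
  Dom : Srt → Type v
  dom_nonempty : ∀ c, Nonempty (Dom c)
  zero : Dom .num
  one : Dom .num
  add : Dom .num → Dom .num → Dom .num
  mul : Dom .num → Dom .num → Dom .num
  len : Dom .str → Dom .num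
  le : Dom .num → Dom .num → Prop
  mem : Dom .num → Dom .str → Prop
  fn : {c : Srt} → {k l : ℕ} → L.Fn c k l → (Fin k → Dom .num) → (Fin l → Dom .str) → Dom c
  rel : {k l : ℕ} → L.Rel k l → (Fin k → Dom .num) → (Fin l → Dom .str) → Prop

/-- Value of a term. -/
def Struc.eval {L : Vocab.{u}} (M : Struc.{u, v} L) : {c : Srt} → {n m : ℕ} → L.Term c n m →
    (Fin n → M.Dom .num) → (Fin m → M.Dom .str) → M.Dom c
  | _, _, _, .nvar i, x, _ => x i
  | _, _, _, .svar i, _, X => X i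
  | _, _, _, .zero, _, _ => M.zero
  | _, _, _, .one, _, _ => M.one
  | _, _, _, .add s t, x, X => M.add (M.eval s x X) (M.eval t x X)
  | _, _, _, .mul s t, x, X => M.mul (M.eval s x X) (M.eval t x X)
  | _, _, _, .len S, x, X => M.len (M.eval S x X)
  | _, _, _, .fn f s S, x, X => M.fn f (fun i => M.eval (s i) x X) (fun j => M.eval (S j) x X)

/-- Truth of a formula under an assignment to its free variables. -/
def Struc.Sat {L : Vocab.{u}} (M : Struc.{u, v} L) : {κ : Kind} → {n m : ℕ} →
    Fm L.Fn L.Rel κ n m → (Fin n → M.Dom .num) → (Fin m → M.Dom .str) → Prop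
  | _, _, _, .tru, _, _ => True
  | _, _, _, .fls, _, _ => False
  | _, _, _, .eqN s t, x, X => M.eval s x X = M.eval t x X
  | _, _, _, .eqS S T, x, X => M.eval S x X = M.eval T x X
  | _, _, _, .le s t, x, X => M.le (M.eval s x X) (M.eval t x X)
  | _, _, _, .mem t S, x, X => M.mem (M.eval t x X) (M.eval S x X)
  | _, _, _, .rel r s S, x, X =>
      M.rel r (fun i => M.eval (s i) x X) (fun j => M.eval (S j) x X)
  | _, _, _, .neg φ, x, X => ¬ M.Sat φ x X
  | _, _, _, .and φ ψ, x, X => M.Sat φ x X ∧ M.Sat ψ x X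
  | _, _, _, .or φ ψ, x, X => M.Sat φ x X ∨ M.Sat ψ x X
  | _, _, _, .exN φ, x, X => ∃ a : M.Dom .num, M.Sat φ (Fin.snoc (α := fun _ => M.Dom .num) x a) X
  | _, _, _, .allN φ, x, X => ∀ a : M.Dom .num, M.Sat φ (Fin.snoc (α := fun _ => M.Dom .num) x a) X
  | _, _, _, .exS φ, x, X => ∃ A : M.Dom .str, M.Sat φ x (Fin.snoc (α := fun _ => M.Dom .str) X A)
  | _, _, _, .allS φ, x, X => ∀ A : M.Dom .str, M.Sat φ x (Fin.snoc (α := fun _ => M.Dom .str) X A)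

/-- The universal closure of a formula is true in the structure. -/
def Struc.Valid {L : Vocab.{u}} (M : Struc.{u, v} L) {κ : Kind} {n m : ℕ}
    (φ : Fm L.Fn L.Rel κ n m) : Prop :=
  ∀ (x : Fin n → M.Dom .num) (X : Fin m → M.Dom .str), M.Sat φ x X

/-- An open (universal) theory: its axioms are the universal closures of a set of open formulas. -/
abbrev OpenTheory (L : Vocab.{u}) : Type u := ∀ n m : ℕ, Set (L.Open n m)

/-- `M` is a model of `T`. -/
def OpenTheory.IsModel {L : Vocab.{u}} (T : OpenTheory L) (M : Struc.{u, v} L) : Prop :=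
  ∀ (n m : ℕ), ∀ α ∈ T n m, M.Valid α

/-- `T ⊢ φ`: the universal closure of `φ` is a logical consequence of `T`, that is, it is true in
all models of `T`.  By the Löwenheim-Skolem theorem, the models whose domains lie in the universe
of the vocabulary suffice. -/
def OpenTheory.Proves {L : Vocab.{u}} (T : OpenTheory L) {κ : Kind} {n m : ℕ}
    (φ : Fm L.Fn L.Rel κ n m) : Prop :=
  ∀ M : Struc.{u, u} L, T.IsModel M → M.Valid φ

/-! ## Inclusions of vocabularies -/

/-- An inclusion of the symbols of `L` into those of `L'`.  Injectivity plays no role and is not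
required. -/
structure Inclusion (L : Vocab.{u}) (L' : Vocab.{w}) : Type (max u w) where
  fn : {c : Srt} → {k l : ℕ} → L.Fn c k l → L'.Fn c k l
  rel : {k l : ℕ} → L.Rel k l → L'.Rel k l

/-- A term of `L` as a term of `L'`. -/
def Inclusion.tm {L : Vocab.{u}} {L' : Vocab.{w}} (ι : Inclusion L L') :
    {c : Srt} → {n m : ℕ} → L.Term c n m → L'.Term c n m
  | _, _, _, .nvar i => .nvar i
  | _, _, _, .svar i => .svar i
  | _, _, _, .zero => .zero
  | _, _, _, .one => .one
  | _, _, _, .add s t => .add (ι.tm s) (ι.tm t)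
  | _, _, _, .mul s t => .mul (ι.tm s) (ι.tm t)
  | _, _, _, .len S => .len (ι.tm S)
  | _, _, _, .fn f s S => .fn (ι.fn f) (fun i => ι.tm (s i)) (fun j => ι.tm (S j))

/-- A formula of `L` as a formula of `L'`. -/
def Inclusion.fm {L : Vocab.{u}} {L' : Vocab.{w}} (ι : Inclusion L L') :
    {κ : Kind} → {n m : ℕ} → Fm L.Fn L.Rel κ n m → Fm L'.Fn L'.Rel κ n m
  | _, _, _, .tru => .tru
  | _, _, _, .fls => .fls
  | _, _, _, .eqN s t => .eqN (ι.tm s) (ι.tm t)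
  | _, _, _, .eqS S T => .eqS (ι.tm S) (ι.tm T)
  | _, _, _, .le s t => .le (ι.tm s) (ι.tm t)
  | _, _, _, .mem t S => .mem (ι.tm t) (ι.tm S)
  | _, _, _, .rel r s S => .rel (ι.rel r) (fun i => ι.tm (s i)) (fun j => ι.tm (S j))
  | _, _, _, .neg φ => .neg (ι.fm φ)
  | _, _, _, .and φ ψ => .and (ι.fm φ) (ι.fm ψ)
  | _, _, _, .or φ ψ => .or (ι.fm φ) (ι.fm ψ)
  | _, _, _, .exN φ => .exN (ι.fm φ)
  | _, _, _, .allN φ => .allN (ι.fm φ)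
  | _, _, _, .exS φ => .exS (ι.fm φ)
  | _, _, _, .allS φ => .allS (ι.fm φ)

/-! ## The vocabulary of `AC⁰` functions and the universal theory `V⁰-bar` -/

/-- The empty family of relation symbols. -/
inductive NoRel : ℕ → ℕ → Type

/-- The function symbols of `L_FAC⁰` beyond the base vocabulary: the smallest family that contains
`pd` and `f_SE` and is closed under `F_{α,t}` and `f_{α,t}`. -/
inductive FACFn : Srt → ℕ → ℕ → Type
  | pd : FACFn .num 1 0
  | fSE : FACFn .num 0 2
  | F {k l : ℕ} (α : Fm FACFn NoRel .qf (k + 1) l) (t : BTm k l) : FACFn .str k l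
  | f {k l : ℕ} (α : Fm FACFn NoRel .qf (k + 1) l) (t : BTm k l) : FACFn .num k l

/-- The vocabulary `L_FAC⁰`. -/
abbrev LFAC : Vocab.{0} := ⟨FACFn, NoRel⟩

/-! The number variables `x`, `y`, `z` and the string variables `X`, `Y`. -/

abbrev xx {n m : ℕ} : LFAC.Term .num (n + 1) m := .nvar 0
abbrev yy {n m : ℕ} : LFAC.Term .num (n + 2) m := .nvar 1
abbrev zz {n m : ℕ} : LFAC.Term .num (n + 3) m := .nvar 2
abbrev XX {n m : ℕ} : LFAC.Term .str n (m + 1) := .svar 0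
abbrev YY {n m : ℕ} : LFAC.Term .str n (m + 2) := .svar 1

/-- The successor `t + 1`. -/
abbrev sc {n m : ℕ} (t : LFAC.Term .num n m) : LFAC.Term .num n m := .add t .one

/-- The predecessor term `pd(t)`. -/
abbrev pdT {n m : ℕ} (t : LFAC.Term .num n m) : LFAC.Term .num n m :=
  .fn FACFn.pd (fun _ => t) Fin.elim0

/-- The open formula `X(z) ↮ Y(z)` in the variables `z`, `X`, `Y`. -/
def differ : LFAC.Open 1 2 := .neg (.iff (.mem xx XX) (.mem xx YY))

/-- The axioms of `V⁰-bar`, the universal theory over `L_FAC⁰`.  The function `f_SE` is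
axiomatized as `f_{α,t}` for `α ≡ X(z) ↮ Y(z)` and `t = |X|`. -/
inductive VbarAx : (n m : ℕ) → LFAC.Open n m → Prop
  | B1 : VbarAx 1 0 (.neg (.eqN (sc xx) .zero))
  | B2 : VbarAx 2 0 (.imp (.eqN (sc xx) (sc yy)) (.eqN xx yy))
  | B3 : VbarAx 1 0 (.eqN (.add xx .zero) xx)
  | B4 : VbarAx 2 0 (.eqN (.add xx (sc yy)) (sc (.add xx yy)))
  | B5 : VbarAx 1 0 (.eqN (.mul xx .zero) .zero)
  | B6 : VbarAx 2 0 (.eqN (.mul xx (sc yy)) (.add (.mul xx yy) xx))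
  | B7 : VbarAx 2 0 (.imp (.and (.le xx yy) (.le yy xx)) (.eqN xx yy))
  | B8 : VbarAx 1 0 (.le .zero xx)
  | B9 : VbarAx 3 0 (.imp (.and (.le xx yy) (.le yy zz)) (.le xx zz))
  | B10 : VbarAx 2 0 (.or (.le xx yy) (.le yy xx))
  | B11 : VbarAx 2 0 (.iff (.le xx yy) (.lt xx (sc yy)))
  | B12a : VbarAx 0 0 (.eqN (pdT .zero) .zero)
  | B12b : VbarAx 1 0 (.imp (.neg (.eqN xx .zero)) (.eqN (sc (pdT xx)) xx))
  | L1 : VbarAx 1 1 (.imp (.mem xx XX) (.lt xx (.len XX)))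
  | L2 : VbarAx 1 1 (.imp (.eqN (sc xx) (.len XX)) (.mem xx XX))
  | SEa : VbarAx 1 2 (.imp (.eqS XX YY) (.and (.eqN (.len XX) (.len YY))
      (.imp (.lt xx (.len XX)) (.iff (.mem xx XX) (.mem xx YY)))))
  | SEb : VbarAx 0 2 (.imp (.and (.eqN (.len XX) (.len YY))
      (.eqN (appVars FACFn.fSE) (.len XX))) (.eqS XX YY))
  | fSE1 : VbarAx 0 2 (minAx1 FACFn.fSE (.len 0))
  | fSE2 : VbarAx 0 2 (minAx2 FACFn.fSE differ (.len 0))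
  | fSE3 : VbarAx 1 2 (minAx3 FACFn.fSE differ)
  | comp {k l : ℕ} (α : LFAC.Open (k + 1) l) (t : BTm k l) :
      VbarAx (k + 1) l (compAx (FACFn.F α t) α t)
  | min1 {k l : ℕ} (α : LFAC.Open (k + 1) l) (t : BTm k l) :
      VbarAx k l (minAx1 (FACFn.f α t) t)
  | min2 {k l : ℕ} (α : LFAC.Open (k + 1) l) (t : BTm k l) :
      VbarAx k l (minAx2 (FACFn.f α t) α t)
  | min3 {k l : ℕ} (α : LFAC.Open (k + 1) l) (t : BTm k l) :
      VbarAx (k + 1) l (minAx3 (FACFn.f α t) α)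

/-- The theory `V⁰-bar`. -/
def Vbar : OpenTheory LFAC := fun n m => {α | VbarAx n m α}

/-! ## The conditions on the theory -/

/-- The theory `T` extends `V⁰-bar` (along an inclusion of the vocabularies). -/
def OpenTheory.ExtendsVbar {L : Vocab.{u}} (T : OpenTheory L) (ι : Inclusion LFAC L) : Prop :=
  ∀ (n m : ℕ), ∀ α ∈ Vbar n m, T.Proves (ι.fm α)

/-- The vocabulary `L` has a string function symbol `F_{α,t}` and a number function symbol
`f_{α,t}` for each open formula `α(z, x⃗, X⃗)` of `L` and each base term `t(x⃗, X⃗)`. -/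
structure ClosedUnderDef (L : Vocab.{u}) : Type u where
  F : {k l : ℕ} → L.Open (k + 1) l → BTm k l → L.Fn .str k l
  f : {k l : ℕ} → L.Open (k + 1) l → BTm k l → L.Fn .num k l

/-- The theory `T` contains the defining axioms of all the functions `F_{α,t}` and `f_{α,t}`. -/
def OpenTheory.HasDefAxioms {L : Vocab.{u}} (T : OpenTheory L) (C : ClosedUnderDef L) : Prop :=
  ∀ (k l : ℕ) (α : L.Open (k + 1) l) (t : BTm k l),
    T.Proves (compAx (C.F α t) α t) ∧
    T.Proves (minAx1 (R := L.Rel) (C.f α t) t) ∧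
    T.Proves (minAx2 (C.f α t) α t) ∧
    T.Proves (minAx3 (C.f α t) α)

/-- All function symbols are provably polynomially bounded: `f(x⃗, X⃗) < p(x⃗, |X⃗|)` for the number
functions and `|F(x⃗, X⃗)| < p(x⃗, |X⃗|)` for the string functions. -/
def OpenTheory.PBounded {L : Vocab.{u}} (T : OpenTheory L) : Prop :=
  (∀ (k l : ℕ) (f : L.Fn .num k l), ∃ p : BTm k l,
    T.Proves (Fm.lt (κ := .qf) (R := L.Rel) (appVars f) p.toTm)) ∧
  (∀ (k l : ℕ) (F : L.Fn .str k l), ∃ p : BTm k l,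
    T.Proves (Fm.lt (κ := .qf) (R := L.Rel) (.len (appVars F)) p.toTm))

/-- The formula `φ(x⃗, X⃗, S⃗)`, where the string terms `S⃗` replace the last `p` string variables. -/
def Fm.substLast {Fn : Srt → ℕ → ℕ → Type u} {R : ℕ → ℕ → Type u} {n m p : ℕ}
    (φ : Fm Fn R .full n (m + p)) (S : Fin p → Tm Fn .str n m) : Fm Fn R .full n m :=
  φ.subst (fun i => .nvar i) (Fin.append (fun j => .svar j) S)

end TwoSorted

open TwoSorted

/-!
The proof is model-theoretic and constructs a structure from Herbrand terms, so that neither a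
proof calculus nor the coding of several strings into one is needed.

*Reduction to prenex formulas.* In the models of `T` every `Σ^B_0` formula is equivalent to an
open one, since `∃ z ≤ t, α(z)` is equivalent to `α(f_{α,t})` (`IsSigma0B.exists_open`). Hence
every `gΣ^B_1` formula is equivalent to a formula in prenex form, whose quantifiers are
existential or of the form `∀ z ≤ t` (`IsGSigma1B.exists_prenex`). A prenex formula is *witnessed*
(`Wit`) if there are terms for its existential quantifiers, depending on the parameters and on the
universally quantified variables further out, that make its matrix true in all models of `T`. It
has to be shown that a prenex formula `g₀` true in all models of `T` is witnessed
(`Prenex.exists_wit`); the terms for the leading block `∃ Z⃗` are then those demanded in the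
theorem.

*Finitely many instances.* A set of instances of formulas is *covered* (`Covered`) if finitely
many open formulas exhaust all cases and under each of them some instance is witnessed. Two facts
about the theory make this notion work. Terms are closed under definition by cases, so witnesses
for several cases combine (`Wit.merge`). And a fresh variable `c`, standing for a counterexample
to `∀ z ≤ t, g`, can be eliminated (`Covered.of_ball`): if `β(c)` says that `g(c)` is witnessed,
then the least `c₀ ≤ t` with `¬ β(c₀)` is given by a term; either `β(c₀)` holds, and `∀ z ≤ t, g`
is witnessed, or `c` may be replaced by `c₀` in the witness of some other instance.

*The limit.* Suppose that `g₀` is not witnessed. Adjoin function symbols for counterexamples to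
the formulas `∀ z ≤ t, g`. The instances `Reach g₀` by the resulting Herbrand terms are to be made
false. Finitely many Herbrand terms involve finitely many counterexamples, which become the fresh
variables of a context when they are introduced in the order of nesting (`Adm`); so by the
preceding step any finitely many open instances in `Reach g₀` are false in some model of `T`
(`exists_model_finite`). A limit along an ultrafilter gives a single structure that consists of
the values of the Herbrand terms (`exists_limit`). It satisfies `T`, because `T` is open, and it
falsifies `g₀`: each witness is the value of a Herbrand term, and the counterexamples are present.

*Function symbols.* If all functions are polynomially bounded, then so are all string terms `S`,
because base terms are monotone, and `S` is equal to `F_{α,t}` with `α ≡ z ∈ S` and `t` a bound on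
`|S|` (`OpenTheory.PBounded.exists_fn`).
-/

namespace TwoSorted

/-- The tuple `x` extended by the last entry `a`, as in the semantics of the quantifiers. -/
local notation:67 x:67 " ▹ " a:68 => Fin.snoc (α := fun _ => _) x a

/-! ### Substitution and evaluation -/

section Semantics

variable {L : Vocab.{u}} (M : Struc.{u, u} L)

theorem Struc.eval_subst {n' m' : ℕ} {c : Srt} {n m : ℕ} (t : Tm L.Fn c n m)
    (σ : Fin n → Tm L.Fn .num n' m') (τ : Fin m → Tm L.Fn .str n' m')
    (x : Fin n' → M.Dom .num) (X : Fin m' → M.Dom .str) :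
    M.eval (t.subst σ τ) x X
      = M.eval t (fun i => M.eval (σ i) x X) (fun j => M.eval (τ j) x X) := by
  induction t <;> simp_all [Tm.subst, Struc.eval]

theorem Struc.eval_liftN {c : Srt} {n m : ℕ} (t : Tm L.Fn c n m)
    (x : Fin n → M.Dom .num) (a : M.Dom .num) (X : Fin m → M.Dom .str) :
    M.eval t.liftN (x ▹ a) X = M.eval t x X := by
  simp [Tm.liftN, Struc.eval_subst, Struc.eval]

theorem Struc.eval_liftS {c : Srt} {n m : ℕ} (t : Tm L.Fn c n m)
    (x : Fin n → M.Dom .num) (X : Fin m → M.Dom .str) (A : M.Dom .str) :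
    M.eval t.liftS x (X ▹ A) = M.eval t x X := by
  simp [Tm.liftS, Struc.eval_subst, Struc.eval]

theorem Struc.eval_snoc {c : Srt} {k n m : ℕ} (σ : Fin k → Tm L.Fn c n m) (t : Tm L.Fn c n m)
    (x : Fin n → M.Dom .num) (X : Fin m → M.Dom .str) :
    (fun i => M.eval ((σ ▹ t) i) x X) = (fun i => M.eval (σ i) x X) ▹ M.eval t x X := by
  funext i
  induction i using Fin.lastCases <;> simp

theorem Struc.sat_subst {κ : Kind} {n m : ℕ} (φ : Fm L.Fn L.Rel κ n m) :
    ∀ {n' m' : ℕ} (σ : Fin n → Tm L.Fn .num n' m') (τ : Fin m → Tm L.Fn .str n' m')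
      (x : Fin n' → M.Dom .num) (X : Fin m' → M.Dom .str),
      M.Sat (φ.subst σ τ) x X
        ↔ M.Sat φ (fun i => M.eval (σ i) x X) (fun j => M.eval (τ j) x X) := by
  induction φ <;> intro n' m' σ τ x X <;>
    simp_all [Fm.subst, Struc.Sat, Struc.eval_subst, Struc.eval_snoc, Struc.eval_liftN,
      Struc.eval_liftS, Struc.eval]

theorem Struc.sat_toFull {κ : Kind} {n m : ℕ} (φ : Fm L.Fn L.Rel κ n m) :
    ∀ (x : Fin n → M.Dom .num) (X : Fin m → M.Dom .str),
      M.Sat φ.toFull x X ↔ M.Sat φ x X := by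
  induction φ <;> intro x X <;> simp_all [Fm.toFull, Struc.Sat]

variable {M} in
theorem Struc.sat_imp {κ : Kind} {n m : ℕ} {φ ψ : Fm L.Fn L.Rel κ n m}
    {x : Fin n → M.Dom .num} {X : Fin m → M.Dom .str} :
    M.Sat (φ.imp ψ) x X ↔ (M.Sat φ x X → M.Sat ψ x X) := by
  simp only [Fm.imp, Struc.Sat]; tauto

variable {M} in
theorem Struc.sat_iff {κ : Kind} {n m : ℕ} {φ ψ : Fm L.Fn L.Rel κ n m}
    {x : Fin n → M.Dom .num} {X : Fin m → M.Dom .str} :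
    M.Sat (φ.iff ψ) x X ↔ (M.Sat φ x X ↔ M.Sat ψ x X) := by
  simp only [Fm.iff, Struc.Sat, Struc.sat_imp]; tauto

/-- The value of a base term. -/
abbrev Struc.bval {n m : ℕ} (t : BTm n m) (x : Fin n → M.Dom .num) (X : Fin m → M.Dom .str) :
    M.Dom .num :=
  M.eval (t.toTm : L.Term .num n m) x X

/-- The strict order `a ≤ b ∧ a ≠ b` of a structure. -/
abbrev Struc.lt (a b : M.Dom .num) : Prop := M.le a b ∧ a ≠ b

end Semantics

/-! ### Arithmetic and extensionality in the models -/

/-- The facts about a structure that the theorem presupposes of the models of `T`: it satisfies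
the axioms of `V⁰-bar` and the defining axioms of the functions `F_{α,t}` and `f_{α,t}`. -/
structure IsStd {L : Vocab.{u}} (ι : Inclusion LFAC L) (C : ClosedUnderDef L)
    (M : Struc.{u, u} L) : Prop where
  vbar : ∀ {n m : ℕ} {α : LFAC.Open n m}, VbarAx n m α → M.Valid (ι.fm α)
  comp : ∀ {k l : ℕ} (α : L.Open (k + 1) l) (t : BTm k l), M.Valid (compAx (C.F α t) α t)
  min1 : ∀ {k l : ℕ} (α : L.Open (k + 1) l) (t : BTm k l),
    M.Valid (minAx1 (R := L.Rel) (C.f α t) t)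
  min2 : ∀ {k l : ℕ} (α : L.Open (k + 1) l) (t : BTm k l), M.Valid (minAx2 (C.f α t) α t)
  min3 : ∀ {k l : ℕ} (α : L.Open (k + 1) l) (t : BTm k l), M.Valid (minAx3 (C.f α t) α)

theorem isStd_of_isModel {L : Vocab.{u}} {ι : Inclusion LFAC L} {C : ClosedUnderDef L}
    {T : OpenTheory L} (hV : T.ExtendsVbar ι) (hC : T.HasDefAxioms C) {M : Struc.{u, u} L}
    (hM : T.IsModel M) : IsStd ι C M where
  vbar h := hV _ _ _ h M hM
  comp α t := (hC _ _ α t).1 M hM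
  min1 α t := (hC _ _ α t).2.1 M hM
  min2 α t := (hC _ _ α t).2.2.1 M hM
  min3 α t := (hC _ _ α t).2.2.2 M hM

/-- The number function taking `x⃗, w, X⃗` to the least `z < w` such that `α(z, x⃗, X⃗)`, and to `w`
if there is none. -/
def leastFn {L : Vocab.{u}} (C : ClosedUnderDef L) {n m : ℕ} (α : L.Open (n + 1) m) :
    L.Fn .num (n + 1) m :=
  C.f (α.subst ((fun i => .nvar i.castSucc.castSucc) ▹ .nvar (Fin.last _)) .svar)
    (.var (Fin.last n))

namespace IsStd

variable {L : Vocab.{u}} {ι : Inclusion LFAC L} {C : ClosedUnderDef L} {M : Struc.{u, u} L}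
  (hM : IsStd ι C M)
include hM

theorem mem_F {k l : ℕ} (α : L.Open (k + 1) l) (t : BTm k l) (x : Fin k → M.Dom .num)
    (X : Fin l → M.Dom .str) (z : M.Dom .num) :
    M.mem z (M.fn (C.F α t) x X) ↔ M.lt z (M.bval t x X) ∧ M.Sat α (x ▹ z) X := by
  have := hM.comp α t (x ▹ z) X
  simpa [compAx, Struc.sat_iff, Struc.Sat, Fm.lt, Struc.eval_liftN, appVars, Struc.eval] using this

theorem f_le {k l : ℕ} (α : L.Open (k + 1) l) (t : BTm k l) (x : Fin k → M.Dom .num)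
    (X : Fin l → M.Dom .str) : M.le (M.fn (C.f α t) x X) (M.bval t x X) := by
  simpa [minAx1, Struc.Sat, appVars, Struc.eval] using hM.min1 α t x X

theorem f_spec {k l : ℕ} (α : L.Open (k + 1) l) (t : BTm k l) (x : Fin k → M.Dom .num)
    (X : Fin l → M.Dom .str) (h : M.fn (C.f α t) x X ≠ M.bval t x X) :
    M.Sat α (x ▹ M.fn (C.f α t) x X) X := by
  have := hM.min2 α t x X
  simp only [minAx2, Struc.sat_imp, Fm.lt, Struc.Sat, appVars, Struc.sat_subst, Struc.eval_snoc,
    Struc.eval] at this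
  exact this ⟨hM.f_le α t x X, h⟩

theorem f_min {k l : ℕ} (α : L.Open (k + 1) l) (t : BTm k l) (x : Fin k → M.Dom .num)
    (X : Fin l → M.Dom .str) {z : M.Dom .num} (h : M.lt z (M.fn (C.f α t) x X)) :
    ¬ M.Sat α (x ▹ z) X := by
  have := hM.min3 α t (x ▹ z) X
  simp only [minAx3, Struc.sat_imp, Fm.lt, Struc.Sat, Struc.eval_liftN, appVars,
    Struc.eval, Fin.snoc_last] at this
  exact this h

theorem le_antisymm {a b : M.Dom .num} (h : M.le a b) (h' : M.le b a) : a = b := by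
  have := hM.vbar .B7 ![a, b] ![]
  simp [Inclusion.fm, Inclusion.tm, Struc.Sat, Struc.eval, Fm.imp] at this
  tauto

theorem zero_le (a : M.Dom .num) : M.le M.zero a := by
  simpa [Inclusion.fm, Inclusion.tm, Struc.Sat, Struc.eval] using hM.vbar .B8 ![a] ![]

theorem le_trans {a b c : M.Dom .num} (h : M.le a b) (h' : M.le b c) : M.le a c := by
  have := hM.vbar .B9 ![a, b, c] ![]
  simp [Inclusion.fm, Inclusion.tm, Struc.Sat, Struc.eval, Fm.imp] at this
  tauto

theorem le_total (a b : M.Dom .num) : M.le a b ∨ M.le b a := by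
  simpa [Inclusion.fm, Inclusion.tm, Struc.Sat, Struc.eval] using hM.vbar .B10 ![a, b] ![]

theorem le_refl (a : M.Dom .num) : M.le a a := (hM.le_total a a).elim id id

theorem le_iff_lt_succ {a b : M.Dom .num} : M.le a b ↔ M.lt a (M.add b M.one) := by
  have := hM.vbar .B11 ![a, b] ![]
  simp [Inclusion.fm, Inclusion.tm, Struc.Sat, Struc.eval, Fm.imp, Fm.iff, Fm.lt] at this
  tauto

theorem add_zero (a : M.Dom .num) : M.add a M.zero = a := by
  simpa [Inclusion.fm, Inclusion.tm, Struc.Sat, Struc.eval] using hM.vbar .B3 ![a] ![]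

theorem add_succ (a b : M.Dom .num) :
    M.add a (M.add b M.one) = M.add (M.add a b) M.one := by
  simpa [Inclusion.fm, Inclusion.tm, Struc.Sat, Struc.eval] using hM.vbar .B4 ![a, b] ![]

theorem mul_zero (a : M.Dom .num) : M.mul a M.zero = M.zero := by
  simpa [Inclusion.fm, Inclusion.tm, Struc.Sat, Struc.eval] using hM.vbar .B5 ![a] ![]

theorem mul_succ (a b : M.Dom .num) :
    M.mul a (M.add b M.one) = M.add (M.mul a b) a := by
  simpa [Inclusion.fm, Inclusion.tm, Struc.Sat, Struc.eval] using hM.vbar .B6 ![a, b] ![]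

theorem exists_succ_eq {a : M.Dom .num} (h : a ≠ M.zero) : ∃ b, M.add b M.one = a := by
  have := hM.vbar .B12b ![a] ![]
  simp [Inclusion.fm, Inclusion.tm, Struc.Sat, Struc.eval, Fm.imp] at this
  exact ⟨_, this.resolve_left h⟩

theorem lt_len_of_mem {a : M.Dom .num} {A : M.Dom .str} (h : M.mem a A) : M.lt a (M.len A) := by
  have := hM.vbar .L1 ![a] ![A]
  simp [Inclusion.fm, Inclusion.tm, Struc.Sat, Struc.eval, Fm.imp, Fm.lt] at this
  tauto

theorem mem_of_succ_eq_len {a : M.Dom .num} {A : M.Dom .str} (h : M.add a M.one = M.len A) :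
    M.mem a A := by
  have := hM.vbar .L2 ![a] ![A]
  simp [Inclusion.fm, Inclusion.tm, Struc.Sat, Struc.eval, Fm.imp] at this
  tauto

theorem lt_succ (a : M.Dom .num) : M.lt a (M.add a M.one) := hM.le_iff_lt_succ.1 (hM.le_refl a)

theorem succ_le_of_lt {a b : M.Dom .num} (h : M.lt a b) : M.le (M.add a M.one) b := by
  refine (hM.le_total _ _).elim id fun h' => ?_
  by_cases e : b = M.add a M.one
  · exact e ▸ hM.le_refl _
  · exact absurd (hM.le_antisymm h.1 (hM.le_iff_lt_succ.2 ⟨h', e⟩)) h.2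

theorem succ_le_succ {a b : M.Dom .num} (h : M.le a b) :
    M.le (M.add a M.one) (M.add b M.one) :=
  hM.succ_le_of_lt (hM.le_iff_lt_succ.1 h)

theorem lt_of_lt_of_le {a b c : M.Dom .num} (h : M.lt a b) (h' : M.le b c) : M.lt a c :=
  ⟨hM.le_trans h.1 h', fun e => h.2 (hM.le_antisymm h.1 (e ▸ h'))⟩

theorem len_le_of_subset {A B : M.Dom .str} (h : ∀ z, M.mem z A → M.mem z B) :
    M.le (M.len A) (M.len B) := by
  by_cases h0 : M.len A = M.zero
  · rw [h0]; exact hM.zero_le _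
  · obtain ⟨b, hb⟩ := hM.exists_succ_eq h0
    rw [← hb]
    exact hM.succ_le_of_lt (hM.lt_len_of_mem (h b (hM.mem_of_succ_eq_len hb)))

/-- Extensionality: the least element of the symmetric difference, `f_SE`, would be a member of
exactly one of the two strings. -/
theorem str_ext {A B : M.Dom .str} (h : ∀ z, M.mem z A ↔ M.mem z B) : A = B := by
  have hl := hM.le_antisymm (hM.len_le_of_subset fun z => (h z).1)
    (hM.len_le_of_subset fun z => (h z).2)
  have h1 := hM.vbar .SEb ![] ![A, B]
  have h2 := hM.vbar .fSE1 ![] ![A, B]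
  have h3 := hM.vbar .fSE2 ![] ![A, B]
  simp [Inclusion.fm, Inclusion.tm, Struc.Sat, Struc.eval, Fm.imp, Fm.iff, Fm.lt, minAx1, minAx2,
    differ, Fm.subst, Tm.subst, appVars, BTm.toTm, Fin.snoc, h, hl] at h1 h2 h3
  tauto

theorem leastFn_spec {n m : ℕ} (α : L.Open (n + 1) m) (x : Fin n → M.Dom .num)
    (X : Fin m → M.Dom .str) (w : M.Dom .num) :
    M.le (M.fn (leastFn C α) (x ▹ w) X) w ∧
    (M.fn (leastFn C α) (x ▹ w) X ≠ w → M.Sat α (x ▹ M.fn (leastFn C α) (x ▹ w) X) X) ∧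
    ∀ z, M.lt z (M.fn (leastFn C α) (x ▹ w) X) → ¬ M.Sat α (x ▹ z) X := by
  let α' : L.Open (n + 1 + 1) m :=
    α.subst ((fun i => .nvar i.castSucc.castSucc) ▹ .nvar (Fin.last _)) .svar
  have key : ∀ z, M.Sat α' (x ▹ w ▹ z) X ↔ M.Sat α (x ▹ z) X := fun z => by
    simp [α', Struc.sat_subst, Struc.eval_snoc, Struc.eval]
  have hw : M.bval (.var (Fin.last n)) (x ▹ w) X = w := by
    simp [Struc.bval, BTm.toTm, Struc.eval]
  refine ⟨?_, fun h => ?_, fun z h => ?_⟩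
  · have h := hM.f_le α' (.var (Fin.last n)) (x ▹ w) X
    rw [hw] at h
    exact h
  · exact (key _).1 (hM.f_spec α' (.var (Fin.last n)) (x ▹ w) X (hw.symm ▸ h))
  · exact fun h' => hM.f_min α' _ _ _ h ((key _).2 h')

/-- Induction for open formulas, from the least number principle. -/
theorem induction {n m : ℕ} (α : L.Open (n + 1) m) (x : Fin n → M.Dom .num)
    (X : Fin m → M.Dom .str) (h0 : M.Sat α (x ▹ M.zero) X)
    (hs : ∀ z, M.Sat α (x ▹ z) X → M.Sat α (x ▹ M.add z M.one) X) (a : M.Dom .num) :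
    M.Sat α (x ▹ a) X := by
  obtain ⟨-, hc, hmin⟩ := hM.leastFn_spec (.neg α) x X a
  set c := M.fn (leastFn C (.neg α)) (x ▹ a) X
  have hcα : M.Sat α (x ▹ c) X := by
    by_cases e : c = M.zero
    · rwa [e]
    · obtain ⟨b, hb⟩ := hM.exists_succ_eq e
      rw [← hb]
      exact hs b (not_not.1 (hmin b (hb ▸ hM.lt_succ b)))
  by_cases e : c = a
  · rwa [← e]
  · exact absurd hcα (hc e)

theorem le_add_right (a b : M.Dom .num) : M.le a (M.add a b) := by
  have := hM.induction (.le (.nvar 0) (.add (.nvar 0) (.nvar 1))) ![a] ![]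
  simp only [Struc.Sat, Struc.eval] at this
  simp [Fin.snoc] at this
  exact this (by rw [hM.add_zero]; exact hM.le_refl a)
    (fun z h => by rw [hM.add_succ]; exact hM.le_trans h (hM.lt_succ _).1) b

theorem le_add_left (a b : M.Dom .num) : M.le b (M.add a b) := by
  have := hM.induction (.le (.nvar 1) (.add (.nvar 0) (.nvar 1))) ![a] ![]
  simp only [Struc.Sat, Struc.eval] at this
  simp [Fin.snoc] at this
  exact this (hM.zero_le _) (fun z h => by rw [hM.add_succ]; exact hM.succ_le_succ h) b

theorem add_le_add_right' {a b : M.Dom .num} (h : M.le a b) (c : M.Dom .num) :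
    M.le (M.add a c) (M.add b c) := by
  have := hM.induction (.le (.add (.nvar 0) (.nvar 2)) (.add (.nvar 1) (.nvar 2))) ![a, b] ![]
  simp only [Struc.Sat, Struc.eval] at this
  simp [Fin.snoc] at this
  exact this (by simpa [hM.add_zero] using h)
    (fun z h => by rw [hM.add_succ, hM.add_succ]; exact hM.succ_le_succ h) c

theorem add_le_add_left' {b c : M.Dom .num} (a : M.Dom .num) (h : M.le b c) :
    M.le (M.add a b) (M.add a c) := by
  have := hM.induction (.imp (.le (.nvar 1) (.nvar 2))
    (.le (.add (.nvar 0) (.nvar 1)) (.add (.nvar 0) (.nvar 2)))) ![a, b] ![]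
  simp only [Struc.Sat, Struc.sat_imp, Struc.eval] at this
  simp [Fin.snoc] at this
  refine this (fun h => ?_) (fun z ih h => ?_) c h
  · rw [hM.le_antisymm h (hM.zero_le b)]; exact hM.le_refl _
  · by_cases e : b = M.add z M.one
    · rw [e]; exact hM.le_refl _
    · rw [hM.add_succ]
      exact hM.le_trans (ih (hM.le_iff_lt_succ.2 ⟨h, e⟩)) (hM.lt_succ _).1

theorem add_le_add' {a b c d : M.Dom .num} (h : M.le a b) (h' : M.le c d) :
    M.le (M.add a c) (M.add b d) :=
  hM.le_trans (hM.add_le_add_right' h c) (hM.add_le_add_left' b h')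

theorem mul_le_mul_right' {a b : M.Dom .num} (h : M.le a b) (c : M.Dom .num) :
    M.le (M.mul a c) (M.mul b c) := by
  have := hM.induction (.le (.mul (.nvar 0) (.nvar 2)) (.mul (.nvar 1) (.nvar 2))) ![a, b] ![]
  simp only [Struc.Sat, Struc.eval] at this
  simp [Fin.snoc] at this
  exact this (by simpa [hM.mul_zero] using hM.le_refl _)
    (fun z ih => by rw [hM.mul_succ, hM.mul_succ]; exact hM.add_le_add' ih h) c

theorem mul_le_mul_left' {b c : M.Dom .num} (a : M.Dom .num) (h : M.le b c) :
    M.le (M.mul a b) (M.mul a c) := by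
  have := hM.induction (.imp (.le (.nvar 1) (.nvar 2))
    (.le (.mul (.nvar 0) (.nvar 1)) (.mul (.nvar 0) (.nvar 2)))) ![a, b] ![]
  simp only [Struc.Sat, Struc.sat_imp, Struc.eval] at this
  simp [Fin.snoc] at this
  refine this (fun h => ?_) (fun z ih h => ?_) c h
  · rw [hM.le_antisymm h (hM.zero_le b)]; exact hM.le_refl _
  · by_cases e : b = M.add z M.one
    · rw [e]; exact hM.le_refl _
    · rw [hM.mul_succ]
      exact hM.le_trans (ih (hM.le_iff_lt_succ.2 ⟨h, e⟩)) (hM.le_add_right _ _)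

theorem mul_le_mul' {a b c d : M.Dom .num} (h : M.le a b) (h' : M.le c d) :
    M.le (M.mul a c) (M.mul b d) :=
  hM.le_trans (hM.mul_le_mul_right' h c) (hM.mul_le_mul_left' b h')

end IsStd

/-! ### Bounded minimization and definition by cases by terms -/

section Terms

variable {L : Vocab.{u}} {ι : Inclusion LFAC L} {C : ClosedUnderDef L}

/-- The term for the least `z < s` such that `α(z)`, with value `s` if there is none. -/
def leastTm (C : ClosedUnderDef L) {n m : ℕ} (α : L.Open (n + 1) m) (s : L.Term .num n m) :
    L.Term .num n m :=
  .fn (leastFn C α) ((fun i => .nvar i) ▹ s) .svar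

theorem IsStd.leastTm_le {M : Struc.{u, u} L} (hM : IsStd ι C M) {n m : ℕ}
    (α : L.Open (n + 1) m) (s : L.Term .num n m) (x : Fin n → M.Dom .num)
    (X : Fin m → M.Dom .str) : M.le (M.eval (leastTm C α s) x X) (M.eval s x X) := by
  simpa [leastTm, Struc.eval, Struc.eval_snoc] using (hM.leastFn_spec α x X (M.eval s x X)).1

/-- Some number up to and including `s` has the property `α` only if `leastTm C α s` has it: if
there is none below `s`, then the term has the value `s`. -/
theorem IsStd.sat_leastTm {M : Struc.{u, u} L} (hM : IsStd ι C M) {n m : ℕ}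
    (α : L.Open (n + 1) m) (s : L.Term .num n m) (x : Fin n → M.Dom .num)
    (X : Fin m → M.Dom .str) {a : M.Dom .num} (ha : M.le a (M.eval s x X))
    (h : M.Sat α (x ▹ a) X) : M.Sat α (x ▹ M.eval (leastTm C α s) x X) X := by
  obtain ⟨-, h2, h3⟩ := hM.leastFn_spec α x X (M.eval s x X)
  have e : M.eval (leastTm C α s) x X = M.fn (leastFn C α) (x ▹ M.eval s x X) X := by
    simp [leastTm, Struc.eval, Struc.eval_snoc]
  rw [e]
  by_cases h' : M.fn (leastFn C α) (x ▹ M.eval s x X) X = M.eval s x X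
  · by_cases h'' : a = M.eval s x X
    · rwa [h', ← h'']
    · exact absurd h (h3 a ⟨h'.symm ▸ ha, h'.symm ▸ h''⟩)
  · exact h2 h'

/-- Definition by cases for number terms: the least `z ≤ s + t` such that `α` and `z = s`, or `¬ α` and
`z = t`. -/
theorem exists_condN (C : ClosedUnderDef L) {n m : ℕ} (α : L.Open n m) (s t : L.Term .num n m) :
    ∃ r : L.Term .num n m, ∀ (ι : Inclusion LFAC L) (M : Struc.{u, u} L), IsStd ι C M →
      ∀ x X, (M.Sat α x X → M.eval r x X = M.eval s x X) ∧
        (¬ M.Sat α x X → M.eval r x X = M.eval t x X) := by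
  let α' : L.Open (n + 1 + 1 + 1) m :=
    α.subst (fun i => .nvar i.castSucc.castSucc.castSucc) .svar
  let β : L.Open (n + 1 + 1 + 1) m :=
    .or (.and α' (.eqN (.nvar (Fin.last _)) (.nvar (Fin.last _).castSucc.castSucc)))
      (.and (.neg α') (.eqN (.nvar (Fin.last _)) (.nvar (Fin.last _).castSucc)))
  let b : BTm (n + 1 + 1) m := .add (.var (Fin.last _).castSucc) (.var (Fin.last _))
  refine ⟨.fn (C.f β b) ((fun i => .nvar i) ▹ s ▹ t) .svar, fun ι M hM x X => ?_⟩
  have e : M.eval (.fn (C.f β b) ((fun i => .nvar i) ▹ s ▹ t) .svar) x X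
      = M.fn (C.f β b) (x ▹ M.eval s x X ▹ M.eval t x X) X := by
    simp [Struc.eval, Struc.eval_snoc]
  have hβ : ∀ c d z, M.Sat β (x ▹ c ▹ d ▹ z) X
      ↔ (M.Sat α x X ∧ z = c ∨ ¬ M.Sat α x X ∧ z = d) := by
    intro c d z
    simp [β, α', Struc.Sat, Struc.sat_subst, Struc.eval]
  have hb : ∀ c d, M.bval b (x ▹ c ▹ d) X = M.add c d := by
    intro c d
    simp [b, Struc.bval, BTm.toTm, Struc.eval]
  rw [e]
  generalize M.eval s x X = c
  generalize M.eval t x X = d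
  have h1 := hM.f_le β b (x ▹ c ▹ d) X
  have h2 := hM.f_spec β b (x ▹ c ▹ d) X
  have h3 := fun z => hM.f_min β b (x ▹ c ▹ d) X (z := z)
  rw [hb] at h1 h2
  simp only [hβ] at h2 h3
  have hc := hM.le_add_right c d
  have hd := hM.le_add_left c d
  constructor
  · intro h
    by_contra hne
    have e2 : M.fn (C.f β b) (x ▹ c ▹ d) X = M.add c d := by
      by_contra h'
      have := h2 h'
      tauto
    rw [← e2] at hc
    exact h3 c ⟨hc, Ne.symm hne⟩ (.inl ⟨h, rfl⟩)
  · intro h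
    by_contra hne
    have e2 : M.fn (C.f β b) (x ▹ c ▹ d) X = M.add c d := by
      by_contra h'
      have := h2 h'
      tauto
    rw [← e2] at hd
    exact h3 d ⟨hd, Ne.symm hne⟩ (.inr ⟨h, rfl⟩)

/-- Definition by cases for string terms, by comprehension with the bound `|S| + |T|`. -/
theorem exists_condS (C : ClosedUnderDef L) {n m : ℕ} (α : L.Open n m) (S T : L.Term .str n m) :
    ∃ R : L.Term .str n m, ∀ (ι : Inclusion LFAC L) (M : Struc.{u, u} L), IsStd ι C M →
      ∀ x X, (M.Sat α x X → M.eval R x X = M.eval S x X) ∧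
        (¬ M.Sat α x X → M.eval R x X = M.eval T x X) := by
  let α' : L.Open (n + 1) (m + 1 + 1) :=
    α.subst (fun i => .nvar i.castSucc) (fun j => .svar j.castSucc.castSucc)
  let β : L.Open (n + 1) (m + 1 + 1) :=
    .or (.and α' (.mem (.nvar (Fin.last _)) (.svar (Fin.last _).castSucc)))
      (.and (.neg α') (.mem (.nvar (Fin.last _)) (.svar (Fin.last _))))
  let b : BTm n (m + 1 + 1) := .add (.len (Fin.last _).castSucc) (.len (Fin.last _))
  refine ⟨.fn (C.F β b) .nvar ((fun j => .svar j) ▹ S ▹ T), fun ι M hM x X => ?_⟩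
  have e : M.eval (.fn (C.F β b) .nvar ((fun j => .svar j) ▹ S ▹ T)) x X
      = M.fn (C.F β b) x (X ▹ M.eval S x X ▹ M.eval T x X) := by
    simp [Struc.eval, Struc.eval_snoc]
  have hβ : ∀ A B z, M.Sat β (x ▹ z) (X ▹ A ▹ B)
      ↔ (M.Sat α x X ∧ M.mem z A ∨ ¬ M.Sat α x X ∧ M.mem z B) := by
    intro A B z
    simp [β, α', Struc.Sat, Struc.sat_subst, Struc.eval]
  have hb : ∀ A B, M.bval b x (X ▹ A ▹ B) = M.add (M.len A) (M.len B) := by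
    intro A B
    simp [b, Struc.bval, BTm.toTm, Struc.eval]
  rw [e]
  generalize M.eval S x X = A
  generalize M.eval T x X = B
  constructor <;> intro h <;> refine hM.str_ext fun z => ?_ <;>
    rw [hM.mem_F, hb, hβ] <;> simp only [h, true_and, false_and, not_true, not_false_eq_true,
      or_false, false_or, and_iff_right_iff_imp]
  · exact fun hz => hM.lt_of_lt_of_le (hM.lt_len_of_mem hz) (hM.le_add_right _ _)
  · exact fun hz => hM.lt_of_lt_of_le (hM.lt_len_of_mem hz) (hM.le_add_left _ _)

end Terms

/-! ### Prenex forms -/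

/-- Prenex `gΣ^B_1` formulas: an open formula preceded by existential quantifiers of both sorts
and universal number quantifiers `∀ z ≤ t`.  The existential quantifiers carry no bounds, since
these can be put into the matrix. -/
inductive Prenex (L : Vocab.{u}) : ℕ → ℕ → Type u
  | qf {n m : ℕ} (α : L.Open n m) : Prenex L n m
  | exN {n m : ℕ} (g : Prenex L (n + 1) m) : Prenex L n m
  | exS {n m : ℕ} (g : Prenex L n (m + 1)) : Prenex L n m
  | ball {n m : ℕ} (t : BTm n m) (g : Prenex L (n + 1) m) : Prenex L n m

/-- Truth of a prenex formula. -/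
def Prenex.Sat {L : Vocab.{u}} (M : Struc.{u, u} L) : {n m : ℕ} → Prenex L n m →
    (Fin n → M.Dom .num) → (Fin m → M.Dom .str) → Prop
  | _, _, .qf α, x, X => M.Sat α x X
  | _, _, .exN g, x, X => ∃ a, g.Sat M (x ▹ a) X
  | _, _, .exS g, x, X => ∃ A, g.Sat M x (X ▹ A)
  | _, _, .ball t g, x, X => ∀ a, M.le a (M.bval t x X) → g.Sat M (x ▹ a) X

/-- The block `∃ Z₁ ⋯ ∃ Z_p` in front of a prenex formula. -/
def Prenex.exSs {L : Vocab.{u}} {n m : ℕ} : (p : ℕ) → Prenex L n (m + p) → Prenex L n m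
  | 0, g => g
  | p + 1, g => Prenex.exSs p (.exS g)

section Prenex

variable {L : Vocab.{u}}

theorem BTm.exists_rename {n m n' m' : ℕ} (t : BTm n m) (r : Fin n → Fin n')
    (q : Fin m → Fin m') : ∃ t' : BTm n' m', ∀ (M : Struc.{u, u} L) x X,
      M.bval t' x X = M.bval t (fun i => x (r i)) (fun j => X (q j)) := by
  induction t with
  | var i => exact ⟨.var (r i), fun M x X => rfl⟩
  | zero => exact ⟨.zero, fun M x X => rfl⟩
  | one => exact ⟨.one, fun M x X => rfl⟩
  | add s t hs ht =>
    obtain ⟨s', hs⟩ := hs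
    obtain ⟨t', ht⟩ := ht
    exact ⟨.add s' t', fun M x X => congrArg₂ M.add (hs M x X) (ht M x X)⟩
  | mul s t hs ht =>
    obtain ⟨s', hs⟩ := hs
    obtain ⟨t', ht⟩ := ht
    exact ⟨.mul s' t', fun M x X => congrArg₂ M.mul (hs M x X) (ht M x X)⟩
  | len j => exact ⟨.len (q j), fun M x X => rfl⟩

theorem snoc_comp_snoc {A : Type*} {n n' : ℕ} (x : Fin n' → A) (a : A) (r : Fin n → Fin n') :
    (fun i => (x ▹ a) (((fun i => (r i).castSucc) ▹ Fin.last n') i)) = (fun i => x (r i)) ▹ a := by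
  funext i
  induction i using Fin.lastCases <;> simp

theorem Prenex.exists_rename {n m : ℕ} (g : Prenex L n m) :
    ∀ {n' m' : ℕ} (r : Fin n → Fin n') (q : Fin m → Fin m'),
      ∃ g' : Prenex L n' m', ∀ (M : Struc.{u, u} L) x X,
        g'.Sat M x X ↔ g.Sat M (fun i => x (r i)) (fun j => X (q j)) := by
  induction g with
  | qf α =>
    intro n' m' r q
    refine ⟨.qf (α.subst (fun i => .nvar (r i)) (fun j => .svar (q j))), fun M x X => ?_⟩
    simp [Prenex.Sat, Struc.sat_subst, Struc.eval]
  | exN g ih =>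
    intro n' m' r q
    obtain ⟨g', h⟩ := ih ((fun i => (r i).castSucc) ▹ Fin.last n') q
    refine ⟨.exN g', fun M x X => ?_⟩
    simp only [Prenex.Sat, h, snoc_comp_snoc]
  | exS g ih =>
    intro n' m' r q
    obtain ⟨g', h⟩ := ih r ((fun i => (q i).castSucc) ▹ Fin.last m')
    refine ⟨.exS g', fun M x X => ?_⟩
    simp only [Prenex.Sat, h, snoc_comp_snoc]
  | ball t g ih =>
    intro n' m' r q
    obtain ⟨g', h⟩ := ih ((fun i => (r i).castSucc) ▹ Fin.last n') q
    obtain ⟨t', ht⟩ := t.exists_rename (L := L) r q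
    refine ⟨.ball t' g', fun M x X => ?_⟩
    simp only [Prenex.Sat, h, snoc_comp_snoc, ht]

theorem Prenex.exists_liftN {n m : ℕ} (g : Prenex L n m) :
    ∃ g' : Prenex L (n + 1) m, ∀ (M : Struc.{u, u} L) x a X,
      g'.Sat M (x ▹ a) X ↔ g.Sat M x X := by
  obtain ⟨g', h⟩ := g.exists_rename Fin.castSucc id
  exact ⟨g', fun M x a X => by simp [h]⟩

theorem Prenex.exists_liftS {n m : ℕ} (g : Prenex L n m) :
    ∃ g' : Prenex L n (m + 1), ∀ (M : Struc.{u, u} L) x X A,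
      g'.Sat M x (X ▹ A) ↔ g.Sat M x X := by
  obtain ⟨g', h⟩ := g.exists_rename id Fin.castSucc
  exact ⟨g', fun M x a X => by simp [h]⟩

/-- A binary connective that distributes over the quantifiers carries prenex formulas to prenex
formulas. The truth function `op` is `And` or `Or`. -/
theorem Prenex.exists_op {op : Prop → Prop → Prop} (hc : ∀ {P Q}, op P Q ↔ op Q P)
    (hop : ∀ {n m : ℕ} (α β : L.Open n m), ∃ γ : L.Open n m, ∀ (M : Struc.{u, u} L) x X,
      M.Sat γ x X ↔ op (M.Sat α x X) (M.Sat β x X))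
    (hex : ∀ {A : Type u} [Nonempty A] {P : A → Prop} {Q : Prop},
      op (∃ a, P a) Q ↔ ∃ a, op (P a) Q)
    (hall : ∀ {A : Type u} {D P : A → Prop} {Q : Prop}, (∃ a, D a) →
      (op (∀ a, D a → P a) Q ↔ ∀ a, D a → op (P a) Q))
    {n m : ℕ} (g₁ : Prenex L n m) :
    ∀ g₂ : Prenex L n m, ∃ g : Prenex L n m, ∀ M : Struc.{u, u} L, (∀ a, M.le a a) →
      ∀ x X, g.Sat M x X ↔ op (g₁.Sat M x X) (g₂.Sat M x X) := by
  induction g₁ with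
  | qf α =>
    intro g₂
    induction g₂ with
    | qf β =>
      obtain ⟨γ, h⟩ := hop α β
      exact ⟨.qf γ, fun M _ x X => h M x X⟩
    | exN g ih =>
      obtain ⟨g', h⟩ := ih (α.subst (fun i => .nvar i.castSucc) .svar)
      refine ⟨.exN g', fun M hM x X => ?_⟩
      have := M.dom_nonempty .num
      rw [hc]
      simp [Prenex.Sat, h M hM, Struc.sat_subst, Struc.eval, hex, hc]
    | exS g ih =>
      obtain ⟨g', h⟩ := ih (α.subst .nvar (fun j => .svar j.castSucc))
      refine ⟨.exS g', fun M hM x X => ?_⟩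
      have := M.dom_nonempty .str
      rw [hc]
      simp [Prenex.Sat, h M hM, Struc.sat_subst, Struc.eval, hex, hc]
    | ball t g ih =>
      obtain ⟨g', h⟩ := ih (α.subst (fun i => .nvar i.castSucc) .svar)
      refine ⟨.ball t g', fun M hM x X => ?_⟩
      rw [hc]
      refine Iff.trans ?_ (hall (D := fun a => M.le a (M.bval t x X)) ⟨_, hM _⟩).symm
      simp [h M hM, Struc.sat_subst, Struc.eval, hc, Prenex.Sat]
  | exN g ih =>
    intro g₂
    obtain ⟨g₂', h₂⟩ := g₂.exists_liftN
    obtain ⟨g', h⟩ := ih g₂'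
    refine ⟨.exN g', fun M hM x X => ?_⟩
    have := M.dom_nonempty .num
    simp [Prenex.Sat, h M hM, h₂, hex]
  | exS g ih =>
    intro g₂
    obtain ⟨g₂', h₂⟩ := g₂.exists_liftS
    obtain ⟨g', h⟩ := ih g₂'
    refine ⟨.exS g', fun M hM x X => ?_⟩
    have := M.dom_nonempty .str
    simp [Prenex.Sat, h M hM, h₂, hex]
  | ball t g ih =>
    intro g₂
    obtain ⟨g₂', h₂⟩ := g₂.exists_liftN
    obtain ⟨g', h⟩ := ih g₂'
    refine ⟨.ball t g', fun M hM x X => ?_⟩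
    refine Iff.trans ?_ (hall (D := fun a => M.le a (M.bval t x X)) ⟨_, hM _⟩).symm
    simp [Prenex.Sat, h M hM, h₂]

theorem Prenex.exists_and {n m : ℕ} (g₁ g₂ : Prenex L n m) :
    ∃ g : Prenex L n m, ∀ M : Struc.{u, u} L, (∀ a, M.le a a) →
      ∀ x X, g.Sat M x X ↔ g₁.Sat M x X ∧ g₂.Sat M x X :=
  Prenex.exists_op (op := And) and_comm (fun α β => ⟨.and α β, fun _ _ _ => Iff.rfl⟩)
    (by simp) (fun ⟨a, ha⟩ => ⟨fun h b hb => ⟨h.1 b hb, h.2⟩,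
      fun h => ⟨fun b hb => (h b hb).1, (h a ha).2⟩⟩) g₁ g₂

theorem Prenex.exists_or {n m : ℕ} (g₁ g₂ : Prenex L n m) :
    ∃ g : Prenex L n m, ∀ M : Struc.{u, u} L, (∀ a, M.le a a) →
      ∀ x X, g.Sat M x X ↔ g₁.Sat M x X ∨ g₂.Sat M x X :=
  Prenex.exists_op (op := Or) or_comm (fun α β => ⟨.or α β, fun _ _ _ => Iff.rfl⟩)
    (fun {A} _ => ⟨fun h => h.elim (fun ⟨a, h⟩ => ⟨a, .inl h⟩)
      fun h => ⟨Classical.arbitrary A, .inr h⟩, fun ⟨a, h⟩ => h.imp_left fun h => ⟨a, h⟩⟩)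
    (fun _ => ⟨fun h b hb => h.imp_left fun h => h b hb,
      fun h => by by_contra h'; push Not at h'; obtain ⟨⟨b, hb, hP⟩, hQ⟩ := h'
                  exact (h b hb).elim hP hQ⟩) g₁ g₂

variable {ι : Inclusion LFAC L} {C : ClosedUnderDef L}

/-- Bounded number quantifiers are eliminated by means of the functions `f_{α,t}`. -/
theorem IsSigma0B.exists_open (C : ClosedUnderDef L) {n m : ℕ} {φ : L.Formula n m}
    (hφ : IsSigma0B φ) : ∃ α : L.Open n m, ∀ (ι : Inclusion LFAC L) (M : Struc.{u, u} L),
      IsStd ι C M → ∀ x X, M.Sat φ x X ↔ M.Sat α x X := by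
  have hex : ∀ {n m : ℕ} (t : BTm n m) (α : L.Open (n + 1) m), ∃ β : L.Open n m,
      ∀ (ι : Inclusion LFAC L) (M : Struc.{u, u} L), IsStd ι C M →
        ∀ x X, (∃ a, M.le a (M.bval t x X) ∧ M.Sat α (x ▹ a) X) ↔ M.Sat β x X := by
    intro n m t α
    refine ⟨α.subst (.nvar ▹ leastTm C α t.toTm) .svar, fun ι M hM x X => ?_⟩
    rw [Struc.sat_subst, Struc.eval_snoc]
    exact ⟨fun ⟨a, h, h'⟩ => hM.sat_leastTm α _ x X h h',
      fun h => ⟨_, hM.leastTm_le α _ x X, h⟩⟩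
  induction hφ with
  | qf α => exact ⟨α, fun ι M _ x X => M.sat_toFull α x X⟩
  | neg _ ih =>
    obtain ⟨α, h⟩ := ih
    exact ⟨.neg α, fun ι M hM x X => not_congr (h ι M hM x X)⟩
  | and _ _ ih ih' =>
    obtain ⟨α, h⟩ := ih
    obtain ⟨β, h'⟩ := ih'
    exact ⟨.and α β, fun ι M hM x X => and_congr (h ι M hM x X) (h' ι M hM x X)⟩
  | or _ _ ih ih' =>
    obtain ⟨α, h⟩ := ih
    obtain ⟨β, h'⟩ := ih'
    exact ⟨.or α β, fun ι M hM x X => or_congr (h ι M hM x X) (h' ι M hM x X)⟩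
  | bexN t _ ih =>
    obtain ⟨α, h⟩ := ih
    obtain ⟨β, hβ⟩ := hex t α
    refine ⟨β, fun ι M hM x X => ?_⟩
    rw [← hβ ι M hM]
    simp [Fm.bexN, Struc.Sat, Struc.eval_liftN, Struc.eval, h ι M hM]
  | ballN t _ ih =>
    obtain ⟨α, h⟩ := ih
    obtain ⟨β, hβ⟩ := hex t (.neg α)
    refine ⟨.neg β, fun ι M hM x X => ?_⟩
    rw [Struc.Sat, ← hβ ι M hM]
    simp [Fm.ballN, Struc.sat_imp, Struc.Sat, Struc.eval_liftN, Struc.eval, h ι M hM]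

theorem IsGSigma1B.exists_prenex (C : ClosedUnderDef L) {n m : ℕ} {φ : L.Formula n m}
    (hφ : IsGSigma1B φ) : ∃ g : Prenex L n m, ∀ (ι : Inclusion LFAC L) (M : Struc.{u, u} L),
      IsStd ι C M → ∀ x X, M.Sat φ x X ↔ g.Sat M x X := by
  induction hφ with
  | base h =>
    obtain ⟨α, h⟩ := h.exists_open C
    exact ⟨.qf α, h⟩
  | and _ _ ih ih' =>
    obtain ⟨g, h⟩ := ih
    obtain ⟨g', h'⟩ := ih'
    obtain ⟨k, hk⟩ := g.exists_and g'
    refine ⟨k, fun ι M hM x X => ?_⟩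
    rw [hk M hM.le_refl, ← h ι M hM, ← h' ι M hM, Struc.Sat]
  | or _ _ ih ih' =>
    obtain ⟨g, h⟩ := ih
    obtain ⟨g', h'⟩ := ih'
    obtain ⟨k, hk⟩ := g.exists_or g'
    refine ⟨k, fun ι M hM x X => ?_⟩
    rw [hk M hM.le_refl, ← h ι M hM, ← h' ι M hM, Struc.Sat]
  | bexN t _ ih =>
    obtain ⟨g, h⟩ := ih
    obtain ⟨k, hk⟩ := Prenex.exists_and (.qf (.le (.nvar (Fin.last _)) t.toTm.liftN)) g
    refine ⟨.exN k, fun ι M hM x X => ?_⟩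
    simp [Fm.bexN, Prenex.Sat, hk M hM.le_refl, Struc.Sat, h ι M hM]
  | ballN t _ ih =>
    obtain ⟨g, h⟩ := ih
    refine ⟨.ball t g, fun ι M hM x X => ?_⟩
    simp [Fm.ballN, Prenex.Sat, Struc.sat_imp, Struc.Sat, Struc.eval_liftN, Struc.eval, h ι M hM]
  | bexS t _ ih =>
    obtain ⟨g, h⟩ := ih
    obtain ⟨k, hk⟩ :=
      Prenex.exists_and (.qf (.le (.len (.svar (Fin.last _))) t.toTm.liftS)) g
    refine ⟨.exS k, fun ι M hM x X => ?_⟩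
    simp [Fm.bexS, Prenex.Sat, hk M hM.le_refl, Struc.Sat, h ι M hM]

theorem Prenex.sat_exSs {M : Struc.{u, u} L} {n m : ℕ} (p : ℕ) :
    ∀ (φ : L.Formula n (m + p)) (g : Prenex L n (m + p)),
      (∀ x X, M.Sat φ x X ↔ g.Sat M x X) →
      ∀ x X, M.Sat (Fm.exSs p φ) x X ↔ (Prenex.exSs p g).Sat M x X := by
  induction p with
  | zero => exact fun φ g h => h
  | succ p ih =>
    exact fun φ g h => ih (.exS φ) (.exS g) fun x X => exists_congr fun A => h x (X ▹ A)

end Prenex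

/-! ### Uniform witnessing of prenex formulas by terms -/

section Witnessing

variable {L : Vocab.{u}}

/-- A relation between assignments to `N` number and `m` string variables, in which witnessing
terms are written, and assignments to the `k` number and `l` string variables of a formula. -/
abbrev EnvRel (L : Vocab.{u}) (N m k l : ℕ) : Type (u + 1) :=
  (M : Struc.{u, u} L) → (Fin N → M.Dom .num) → (Fin m → M.Dom .str) →
    (Fin k → M.Dom .num) → (Fin l → M.Dom .str) → Prop

/-- `Wit T g E`: there are terms for the existential quantifiers of `g`, depending on the variables
`x⃗, X⃗` and on the universally quantified variables further out, that make the matrix of `g` true in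
all models of `T` under all assignments `s⃗, S⃗` that `E` relates to `x⃗, X⃗`.  The relation `E` plays
the role of a substitution `s⃗ = s⃗(x⃗, X⃗)`, `S⃗ = S⃗(x⃗, X⃗)` and of a hypothesis on `x⃗, X⃗` at the same
time; each number quantifier `∀ z ≤ t` adds `z` to the variables `x⃗` and `z ≤ t` to the
hypothesis. -/
def Wit (T : OpenTheory L) {m : ℕ} : {k l : ℕ} → Prenex L k l → {N : ℕ} → EnvRel L N m k l → Prop
  | _, _, .qf α, _, E => ∀ M, T.IsModel M → ∀ x X s S, E M x X s S → M.Sat α s S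
  | _, _, .exN g, N, E => ∃ u : L.Term .num N m,
      Wit T g (N := N) fun M x X s' S => ∃ s, E M x X s S ∧ s' = s ▹ M.eval u x X
  | _, _, .exS g, N, E => ∃ U : L.Term .str N m,
      Wit T g (N := N) fun M x X s S' => ∃ S, E M x X s S ∧ S' = S ▹ M.eval U x X
  | _, _, .ball t g, N, E =>
      Wit T g (N := N + 1) fun M x' X s' S =>
        ∃ x s a, E M x X s S ∧ M.le a (M.bval t s S) ∧ x' = x ▹ a ∧ s' = s ▹ a

variable {T : OpenTheory L}

theorem Wit.anti {m k l : ℕ} {g : Prenex L k l} :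
    ∀ {N : ℕ} {E E' : EnvRel L N m k l},
      (∀ M, T.IsModel M → ∀ x X s S, E M x X s S → E' M x X s S) → Wit T g E' → Wit T g E := by
  induction g with
  | qf α => exact fun h hW M hM x X s S hE => hW M hM x X s S (h M hM x X s S hE)
  | exN g ih =>
    rintro N E E' h ⟨u, hW⟩
    exact ⟨u, ih (fun M hM x X s' S ⟨s, hE, e⟩ => ⟨s, h M hM x X s S hE, e⟩) hW⟩
  | exS g ih =>
    rintro N E E' h ⟨U, hW⟩
    exact ⟨U, ih (fun M hM x X s S' ⟨S, hE, e⟩ => ⟨S, h M hM x X s S hE, e⟩) hW⟩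
  | ball t g ih =>
    intro N E E' h hW
    exact ih (fun M hM x' X s' S ⟨x, s, a, hE, e⟩ => ⟨x, s, a, h M hM x X s S hE, e⟩) hW

theorem Wit.sound {m k l : ℕ} {g : Prenex L k l} :
    ∀ {N : ℕ} {E : EnvRel L N m k l}, Wit T g E →
      ∀ M, T.IsModel M → ∀ x X s S, E M x X s S → g.Sat M s S := by
  induction g with
  | qf α => exact fun hW => hW
  | exN g ih =>
    rintro N E ⟨u, hW⟩ M hM x X s S hE
    exact ⟨_, ih hW M hM x X _ S ⟨s, hE, rfl⟩⟩
  | exS g ih =>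
    rintro N E ⟨U, hW⟩ M hM x X s S hE
    exact ⟨_, ih hW M hM x X s _ ⟨S, hE, rfl⟩⟩
  | ball t g ih =>
    intro N E hW M hM x X s S hE a ha
    exact ih hW M hM (x ▹ a) X _ S ⟨x, s, a, hE, ha, rfl, rfl⟩

theorem Wit.subst {m k l : ℕ} {g : Prenex L k l} :
    ∀ {N N' : ℕ} {E : EnvRel L N m k l} (σ : Fin N → L.Term .num N' m), Wit T g E →
      Wit T g fun M x X s S => E M (fun i => M.eval (σ i) x X) X s S := by
  induction g with
  | qf α => exact fun σ hW M hM x X s S hE => hW M hM _ X s S hE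
  | exN g ih =>
    rintro N N' E σ ⟨u, hW⟩
    refine ⟨u.subst σ .svar, (ih σ hW).anti ?_⟩
    rintro M hM x X s' S ⟨s, hE, rfl⟩
    exact ⟨s, hE, by simp [Struc.eval_subst, Struc.eval]⟩
  | exS g ih =>
    rintro N N' E σ ⟨U, hW⟩
    refine ⟨U.subst σ .svar, (ih σ hW).anti ?_⟩
    rintro M hM x X s S' ⟨S, hE, rfl⟩
    exact ⟨S, hE, by simp [Struc.eval_subst, Struc.eval]⟩
  | ball t g ih =>
    intro N N' E σ hW
    refine (ih ((fun i => (σ i).liftN) ▹ .nvar (Fin.last N')) hW).anti ?_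
    rintro M hM x' X s' S ⟨x, s, a, hE, ha, rfl, rfl⟩
    exact ⟨_, s, a, hE, ha, by simp [Struc.eval_snoc, Struc.eval_liftN, Struc.eval], rfl⟩

theorem Wit.of_empty (C : ClosedUnderDef L) {m k l : ℕ} {g : Prenex L k l} :
    ∀ {N : ℕ} {E : EnvRel L N m k l}, (∀ M x X s S, ¬ E M x X s S) → Wit T g E := by
  induction g with
  | qf α => exact fun h M hM x X s S hE => absurd hE (h M x X s S)
  | exN g ih =>
    intro N E h
    exact ⟨.zero, ih fun M x X s' S ⟨s, hE, _⟩ => h M x X s S hE⟩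
  | exS g ih =>
    intro N E h
    exact ⟨appVars (C.F .tru .zero), ih fun M x X s S' ⟨S, hE, _⟩ => h M x X s S hE⟩
  | ball t g ih =>
    intro N E h
    exact ih fun M x' X s' S ⟨x, s, a, hE, _⟩ => h M x X s S hE

variable {ι : Inclusion LFAC L} {C : ClosedUnderDef L}

/-- Witnesses that work if `δ` holds and witnesses that work otherwise combine to witnesses that
work always, because terms are closed under definition by cases. -/
theorem Wit.merge (hT : ∀ M : Struc.{u, u} L, T.IsModel M → IsStd ι C M) {m k l : ℕ}
    {g : Prenex L k l} :
    ∀ {N : ℕ} {E : EnvRel L N m k l} (δ : L.Open N m),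
      Wit T g (fun M x X s S => E M x X s S ∧ M.Sat δ x X) →
      Wit T g (fun M x X s S => E M x X s S ∧ ¬ M.Sat δ x X) → Wit T g E := by
  induction g with
  | qf α =>
    intro N E δ h h' M hM x X s S hE
    by_cases hδ : M.Sat δ x X
    · exact h M hM x X s S ⟨hE, hδ⟩
    · exact h' M hM x X s S ⟨hE, hδ⟩
  | exN g ih =>
    rintro N E δ ⟨u, h⟩ ⟨u', h'⟩
    obtain ⟨r, hr⟩ := exists_condN C δ u u'
    refine ⟨r, ih δ (h.anti ?_) (h'.anti ?_)⟩ <;> rintro M hM x X _ S ⟨⟨s, hE, rfl⟩, hδ⟩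
    · exact ⟨s, ⟨hE, hδ⟩, by rw [(hr ι M (hT M hM) x X).1 hδ]⟩
    · exact ⟨s, ⟨hE, hδ⟩, by rw [(hr ι M (hT M hM) x X).2 hδ]⟩
  | exS g ih =>
    rintro N E δ ⟨u, h⟩ ⟨u', h'⟩
    obtain ⟨r, hr⟩ := exists_condS C δ u u'
    refine ⟨r, ih δ (h.anti ?_) (h'.anti ?_)⟩ <;> rintro M hM x X s _ ⟨⟨S, hE, rfl⟩, hδ⟩
    · exact ⟨S, ⟨hE, hδ⟩, by rw [(hr ι M (hT M hM) x X).1 hδ]⟩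
    · exact ⟨S, ⟨hE, hδ⟩, by rw [(hr ι M (hT M hM) x X).2 hδ]⟩
  | ball t g ih =>
    intro N E δ h h'
    refine ih (δ.subst (fun i => .nvar i.castSucc) .svar) (Wit.anti ?_ h) (Wit.anti ?_ h') <;>
      rintro M hM _ X _ S ⟨⟨x, s, a, hE, ha, rfl, rfl⟩, hδ⟩ <;>
      exact ⟨x, s, a, ⟨hE, by simpa [Struc.sat_subst, Struc.eval] using hδ⟩, ha, rfl, rfl⟩

/-- A prenex formula together with terms, in `N` number and `m` string variables, substituted for
its free variables. -/
structure Inst (L : Vocab.{u}) (N m : ℕ) : Type u where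
  {k l : ℕ}
  g : Prenex L k l
  s : Fin k → L.Term .num N m
  S : Fin l → L.Term .str N m

/-- An instance regarded in the scope of one more number variable. -/
def Inst.lift {N m : ℕ} (I : Inst L N m) : Inst L (N + 1) m :=
  ⟨I.g, fun i => (I.s i).liftN, fun j => (I.S j).liftN⟩

/-- The instance is witnessed by terms under the hypothesis `δ`. -/
def Inst.WitBy (T : OpenTheory L) {N m : ℕ} (I : Inst L N m) (δ : L.Open N m) : Prop :=
  Wit T I.g fun M x X s S =>
    M.Sat δ x X ∧ s = (fun i => M.eval (I.s i) x X) ∧ S = (fun j => M.eval (I.S j) x X)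

/-- The disjunction of the instances in `Δ` is witnessed: finitely many open formulas cover all
cases, and under each of them some instance in `Δ` is witnessed by terms. -/
def Covered (T : OpenTheory L) {N m : ℕ} (Δ : Set (Inst L N m)) : Prop :=
  ∃ ds : List (L.Open N m), (∀ δ ∈ ds, ∃ I ∈ Δ, I.WitBy T δ) ∧
    ∀ M : Struc.{u, u} L, T.IsModel M → ∀ x X, ∃ δ ∈ ds, M.Sat δ x X

/-- The disjunction of a list of open formulas. -/
def disj {N m : ℕ} (ds : List (L.Open N m)) : L.Open N m := ds.foldr .or .fls

theorem sat_disj {M : Struc.{u, u} L} {N m : ℕ} (ds : List (L.Open N m)) (x : Fin N → M.Dom .num)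
    (X : Fin m → M.Dom .str) : M.Sat (disj ds) x X ↔ ∃ δ ∈ ds, M.Sat δ x X := by
  induction ds with
  | nil => simp [disj, Struc.Sat]
  | cons δ ds ih => simpa [disj, Struc.Sat] using or_congr_right ih

theorem Inst.WitBy.disj (hT : ∀ M : Struc.{u, u} L, T.IsModel M → IsStd ι C M) {N m : ℕ}
    {I : Inst L N m} {ds : List (L.Open N m)} (h : ∀ δ ∈ ds, I.WitBy T δ) :
    I.WitBy T (disj ds) := by
  induction ds with
  | nil => exact Wit.of_empty C fun M x X s S h => h.1
  | cons δ ds ih =>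
    refine Wit.merge hT δ ((h δ (by simp)).anti ?_)
      ((ih fun δ' h' => h δ' (by simp [h'])).anti ?_)
    · exact fun M hM x X s S h => ⟨h.2, h.1.2⟩
    · exact fun M hM x X s S h => ⟨h.1.1.resolve_left h.2, h.1.2⟩

theorem Inst.WitBy.of_lift {N m : ℕ} {I : Inst L N m} {δ : L.Open (N + 1) m}
    (h : I.lift.WitBy T δ) (c : L.Term .num N m) :
    I.WitBy T (δ.subst (.nvar ▹ c) .svar) := by
  refine (Wit.subst (.nvar ▹ c) h).anti ?_
  rintro M hM x X s S ⟨hδ, rfl, rfl⟩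
  refine ⟨(M.sat_subst _ _ _ _ _).1 hδ, ?_, ?_⟩ <;> funext i <;>
    simp [Inst.lift, Struc.eval_snoc, Struc.eval_liftN, Struc.eval]

theorem Covered.mono {N m : ℕ} {Δ Δ' : Set (Inst L N m)} (h : Covered T Δ) (hΔ : Δ ⊆ Δ') :
    Covered T Δ' := by
  obtain ⟨ds, h1, h2⟩ := h
  exact ⟨ds, fun δ hδ => let ⟨I, hI, h⟩ := h1 δ hδ; ⟨I, hΔ hI, h⟩, h2⟩

theorem Covered.of_lift {N m : ℕ} {Δ : Set (Inst L N m)} (h : Covered T (Inst.lift '' Δ)) :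
    Covered T Δ := by
  obtain ⟨ds, h1, h2⟩ := h
  refine ⟨ds.map fun δ => δ.subst (.nvar ▹ .zero) .svar, fun δ' hδ' => ?_, fun M hM x X => ?_⟩
  · obtain ⟨δ, hδ, rfl⟩ := List.mem_map.1 hδ'
    obtain ⟨_, ⟨I, hI, rfl⟩, h⟩ := h1 δ hδ
    exact ⟨I, hI, h.of_lift .zero⟩
  · obtain ⟨δ, hδ, h⟩ := h2 M hM (x ▹ M.zero) X
    exact ⟨_, List.mem_map_of_mem hδ,
      (M.sat_subst _ _ _ _ _).2 (by simpa [Struc.eval_snoc, Struc.eval] using h)⟩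

/-- The instance `¬ z ≤ t(s⃗, S⃗)` of an open formula, for terms `z`, `s⃗`, `S⃗`. -/
def gtInst {N m k l : ℕ} (t : BTm k l) (s : Fin k → L.Term .num N m) (z : L.Term .num N m)
    (S : Fin l → L.Term .str N m) : Inst L N m :=
  ⟨.qf (.neg (.le (.nvar (Fin.last k)) t.toTm.liftN)), s ▹ z, S⟩

/-- Elimination of a fresh variable `c`, which stands for a counterexample to the instance
`∀ z ≤ t, g`.  Let `β(c)` say that `g(c)` is witnessed, and let `c₀` be the least `c ≤ t` such that
`¬ β(c)`.  If `β(c₀)` holds, then `β(c)` for all `c ≤ t`, and `∀ z ≤ t, g` is witnessed; otherwise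
`c := c₀` leads to a witness for one of the instances in which `c` does not occur. -/
theorem Covered.of_ball (hT : ∀ M : Struc.{u, u} L, T.IsModel M → IsStd ι C M) {N m k l : ℕ}
    {Δ : Set (Inst L N m)} {t : BTm k l} {g : Prenex L (k + 1) l}
    {s : Fin k → L.Term .num N m} {S : Fin l → L.Term .str N m}
    (hΔ : ∀ δ, Inst.WitBy T ⟨.ball t g, s, S⟩ δ → ∃ I ∈ Δ, I.WitBy T δ)
    (h : Covered T (Inst.lift '' Δ ∪
      {gtInst t (fun i => (s i).liftN) (.nvar (Fin.last N)) (fun j => (S j).liftN),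
        ⟨g, (fun i => (s i).liftN) ▹ .nvar (Fin.last N), fun j => (S j).liftN⟩})) :
    Covered T Δ := by
  classical
  obtain ⟨ds, h1, h2⟩ := h
  let J : Inst L (N + 1) m :=
    ⟨g, (fun i => (s i).liftN) ▹ .nvar (Fin.last N), fun j => (S j).liftN⟩
  let β : L.Open (N + 1) m := disj (ds.filter fun δ => J.WitBy T δ)
  have hβ : J.WitBy T β := Inst.WitBy.disj hT fun δ hδ => by simpa using (List.mem_filter.1 hδ).2
  let b : L.Term .num N m := t.toTm.subst s S
  have hb : ∀ (M : Struc.{u, u} L) x X, M.eval b x X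
      = M.bval t (fun i => M.eval (s i) x X) (fun j => M.eval (S j) x X) :=
    fun M x X => M.eval_subst _ _ _ _ _
  let c₀ : L.Term .num N m := leastTm C (.neg β) b
  let σ : L.Open (N + 1) m → L.Open N m := fun δ => δ.subst (.nvar ▹ c₀) .svar
  have hσ : ∀ (M : Struc.{u, u} L) x X δ, M.Sat (σ δ) x X ↔ M.Sat δ (x ▹ M.eval c₀ x X) X := by
    intro M x X δ
    simp [σ, Struc.sat_subst, Struc.eval_snoc, Struc.eval]
  refine ⟨σ β :: (ds.filter fun δ => ∃ I ∈ Δ, I.lift.WitBy T δ).map σ, ?_, fun M hM x X => ?_⟩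
  · intro δ' hδ'
    rcases List.mem_cons.1 hδ' with rfl | hδ'
    · refine hΔ _ ?_
      change Wit T g (N := N + 1) _
      refine Wit.anti ?_ hβ
      rintro M hM _ X _ S' ⟨x, s', a, ⟨hδ, rfl, rfl⟩, ha, rfl, rfl⟩
      refine ⟨?_, ?_, ?_⟩
      · by_contra hn
        exact (hT M hM).sat_leastTm (.neg β) b x X (by rwa [hb]) hn ((hσ M x X β).1 hδ)
      · refine Eq.trans ?_ (M.eval_snoc (fun i => (s i).liftN) (.nvar (Fin.last N)) _ X).symm
        simp [Struc.eval_liftN, Struc.eval]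
      · funext j
        exact (M.eval_liftN (S j) x a X).symm
    · obtain ⟨δ, hδ, rfl⟩ := List.mem_map.1 hδ'
      obtain ⟨I, hI, h⟩ : ∃ I ∈ Δ, I.lift.WitBy T δ := by simpa using (List.mem_filter.1 hδ).2
      exact ⟨I, hI, h.of_lift c₀⟩
  · obtain ⟨δ, hδ, hs⟩ := h2 M hM (x ▹ M.eval c₀ x X) X
    obtain ⟨I, hI, hW⟩ := h1 δ hδ
    rcases hI with ⟨I, hI, rfl⟩ | rfl | rfl
    · refine ⟨σ δ, List.mem_cons_of_mem _ (List.mem_map_of_mem (List.mem_filter.2 ⟨hδ, ?_⟩)),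
        (hσ M x X δ).2 hs⟩
      simpa using ⟨I, hI, hW⟩
    · have := hW M hM _ X _ _ ⟨hs, rfl, rfl⟩
      refine absurd ((hT M hM).leastTm_le (.neg β) b x X) ?_
      simpa [gtInst, Struc.Sat, Struc.eval_snoc, Struc.eval_liftN, Struc.eval, hb] using this
    · refine ⟨σ β, by simp, (hσ M x X β).2 ((sat_disj _ _ _).2 ⟨δ, ?_, hs⟩)⟩
      exact List.mem_filter.2 ⟨hδ, by simpa using hW⟩

theorem exists_of_not_covered {N m : ℕ} {Δ : Set (Inst L N m)} (h : ¬ Covered T Δ)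
    {ds : List (L.Open N m)} (hds : ∀ δ ∈ ds, ∃ I ∈ Δ, I.WitBy T δ) :
    ∃ M : Struc.{u, u} L, T.IsModel M ∧ ∃ x X, ∀ δ ∈ ds, ¬ M.Sat δ x X := by
  by_contra! h'
  exact h ⟨ds, hds, h'⟩

theorem Inst.witBy_qf {N m k l : ℕ} (α : L.Open k l) (s : Fin k → L.Term .num N m)
    (S : Fin l → L.Term .str N m) : Inst.WitBy T ⟨.qf α, s, S⟩ (α.subst s S) := by
  rintro M hM x X _ _ ⟨h, rfl, rfl⟩
  exact (M.sat_subst _ _ _ _ _).1 h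

theorem Covered.wit (hT : ∀ M : Struc.{u, u} L, T.IsModel M → IsStd ι C M) {n m : ℕ}
    {g : Prenex L n m} (h : Covered T {⟨g, .nvar, .svar⟩}) :
    Wit T g (N := n) (m := m) fun _ x X s S => s = x ∧ S = X := by
  obtain ⟨ds, h1, h2⟩ := h
  refine Wit.anti ?_ (Inst.WitBy.disj hT (I := ⟨g, .nvar, .svar⟩) (ds := ds) fun δ hδ => ?_)
  · rintro M hM x X _ _ ⟨rfl, rfl⟩
    exact ⟨(sat_disj _ _ _).2 (h2 M hM _ _), rfl, rfl⟩
  · obtain ⟨I, rfl, h⟩ := h1 δ hδ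
    exact h

end Witnessing

/-! ### Herbrand terms -/

section Herbrand

/-- The function symbols of `L` and, for each prenex formula `∀ z ≤ t, g`, a new symbol for a
counterexample `z` to it, as a function of the free variables of the formula. -/
inductive HFn (L : Vocab.{u}) : Srt → ℕ → ℕ → Type u
  | base {c : Srt} {k l : ℕ} (f : L.Fn c k l) : HFn L c k l
  | cex {k l : ℕ} (t : BTm k l) (g : Prenex L (k + 1) l) : HFn L .num k l

/-- Herbrand terms: terms built from the symbols of `L` and the symbols for counterexamples. A term
that starts with a symbol for a counterexample serves as a name for a number, and no structure
interprets the symbol itself. -/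
abbrev HTm (L : Vocab.{u}) (c : Srt) (n m : ℕ) : Type u := Tm (HFn L) c n m

variable {L : Vocab.{u}}

/-- The Herbrand term obtained from a term of `L` by substitution. -/
def nameTm {n m : ℕ} : {c : Srt} → {k l : ℕ} → L.Term c k l → (Fin k → HTm L .num n m) →
    (Fin l → HTm L .str n m) → HTm L c n m
  | _, _, _, .nvar i, ρ, _ => ρ i
  | _, _, _, .svar j, _, τ => τ j
  | _, _, _, .zero, _, _ => .zero
  | _, _, _, .one, _, _ => .one
  | _, _, _, .add s t, ρ, τ => .add (nameTm s ρ τ) (nameTm t ρ τ)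
  | _, _, _, .mul s t, ρ, τ => .mul (nameTm s ρ τ) (nameTm t ρ τ)
  | _, _, _, .len S, ρ, τ => .len (nameTm S ρ τ)
  | _, _, _, .fn f s S, ρ, τ =>
      .fn (.base f) (fun i => nameTm (s i) ρ τ) (fun j => nameTm (S j) ρ τ)

/-- The value of a Herbrand term, given values for the number variables and for the terms that
start with a symbol for a counterexample. -/
def hval (M : Struc.{u, u} L) : {c : Srt} → {n m : ℕ} → HTm L c n m →
    (HTm L .num n m → M.Dom .num) → (Fin m → M.Dom .str) → M.Dom c
  | _, _, _, .nvar i, v, _ => v (.nvar i)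
  | _, _, _, .svar j, _, X => X j
  | _, _, _, .zero, _, _ => M.zero
  | _, _, _, .one, _, _ => M.one
  | _, _, _, .add s t, v, X => M.add (hval M s v X) (hval M t v X)
  | _, _, _, .mul s t, v, X => M.mul (hval M s v X) (hval M t v X)
  | _, _, _, .len S, v, X => M.len (hval M S v X)
  | _, _, _, .fn (.base f) s S, v, X =>
      M.fn f (fun i => hval M (s i) v X) (fun j => hval M (S j) v X)
  | _, _, _, .fn (.cex t g) s S, v, _ => v (.fn (.cex t g) s S)

theorem hval_nameTm (M : Struc.{u, u} L) {n m : ℕ} {c : Srt} {k l : ℕ} (t : L.Term c k l)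
    (ρ : Fin k → HTm L .num n m) (τ : Fin l → HTm L .str n m)
    (v : HTm L .num n m → M.Dom .num) (X : Fin m → M.Dom .str) :
    hval M (nameTm t ρ τ) v X
      = M.eval t (fun i => hval M (ρ i) v X) (fun j => hval M (τ j) v X) := by
  induction t <;> simp_all [nameTm, hval, Struc.eval]

theorem nameTm_liftN {n m : ℕ} {c : Srt} {k l : ℕ} (t : L.Term c k l)
    (ρ : Fin k → HTm L .num n m) (h : HTm L .num n m) (τ : Fin l → HTm L .str n m) :
    nameTm t.liftN (ρ ▹ h) τ = nameTm t ρ τ := by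
  unfold Tm.liftN
  induction t <;> simp_all [nameTm, Tm.subst]

/-- The variables and the Herbrand terms that start with a symbol for a counterexample. -/
def IsAtom {n m : ℕ} (h : HTm L .num n m) : Prop :=
  (∃ i, h = .nvar i) ∨ ∃ (k l : ℕ) (t : BTm k l) (g : Prenex L (k + 1) l) (s : _) (S : _),
    h = .fn (.cex t g) s S

theorem nameTm_eq_atom {n m N : ℕ} {ρ : Fin N → HTm L .num n m} {h : HTm L .num n m}
    (hh : IsAtom h) {t : L.Term .num N m} (e : nameTm t ρ .svar = h) :
    ∃ i, t = .nvar i ∧ ρ i = h := by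
  cases t with
  | nvar i => exact ⟨i, rfl, e⟩
  | fn f s S =>
    rcases hh with ⟨i, rfl⟩ | ⟨k, l, t, g, s, S, rfl⟩
    · cases e
    · simp only [nameTm, Tm.fn.injEq] at e
      obtain ⟨rfl, rfl, hf, -⟩ := e
      cases hf
  | _ => rcases hh with ⟨i, rfl⟩ | ⟨k, l, t, g, s, S, rfl⟩ <;> cases e

theorem nameTm_injective {n m N : ℕ} {ρ : Fin N → HTm L .num n m} (hρ : ∀ i, IsAtom (ρ i))
    (hi : Function.Injective ρ) {c : Srt} (t : L.Term c N m) :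
    ∀ t' : L.Term c N m, nameTm t ρ .svar = nameTm t' ρ .svar → t = t' := by
  induction t with
  | nvar i =>
    intro t' e
    obtain ⟨j, rfl, h⟩ := nameTm_eq_atom (hρ i) e.symm
    rw [hi h]
  | svar j => intro t' e; cases t' <;> simp_all [nameTm]
  | zero =>
    intro t' e
    cases t' with
    | nvar i => obtain ⟨j, h, -⟩ := nameTm_eq_atom (hρ i) e; cases h
    | _ => simp_all [nameTm]
  | one =>
    intro t' e
    cases t' with
    | nvar i => obtain ⟨j, h, -⟩ := nameTm_eq_atom (hρ i) e; cases h
    | _ => simp_all [nameTm]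
  | add s t ihs iht =>
    intro t' e
    cases t' with
    | nvar i => obtain ⟨j, h, -⟩ := nameTm_eq_atom (hρ i) e; cases h
    | add s' t' =>
      simp only [nameTm, Tm.add.injEq] at e
      rw [ihs hρ hi s' e.1, iht hρ hi t' e.2]
    | _ => simp_all [nameTm]
  | mul s t ihs iht =>
    intro t' e
    cases t' with
    | nvar i => obtain ⟨j, h, -⟩ := nameTm_eq_atom (hρ i) e; cases h
    | mul s' t' =>
      simp only [nameTm, Tm.mul.injEq] at e
      rw [ihs hρ hi s' e.1, iht hρ hi t' e.2]
    | _ => simp_all [nameTm]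
  | len S ih =>
    intro t' e
    cases t' with
    | nvar i => obtain ⟨j, h, -⟩ := nameTm_eq_atom (hρ i) e; cases h
    | len S' =>
      simp only [nameTm, Tm.len.injEq] at e
      rw [ih hρ hi S' e]
    | _ => simp_all [nameTm]
  | fn f s S ihs ihS =>
    intro t' e
    cases t' with
    | nvar i => obtain ⟨j, h, -⟩ := nameTm_eq_atom (hρ i) e; cases h
    | fn f' s' S' =>
      simp only [nameTm, Tm.fn.injEq] at e
      obtain ⟨rfl, rfl, hf, hs, hS⟩ := e
      cases eq_of_heq hf
      rw [funext fun i => ihs i hρ hi (s' i) (congrFun (eq_of_heq hs) i),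
        funext fun j => ihS j hρ hi (S' j) (congrFun (eq_of_heq hS) j)]
    | _ => simp_all [nameTm]

/-- The instances by Herbrand terms of the subformulas of `g₀` that the construction makes false
in order to make `g₀` false. -/
inductive Reach {n m : ℕ} (g₀ : Prenex L n m) : {k l : ℕ} → Prenex L k l →
    (Fin k → HTm L .num n m) → (Fin l → HTm L .str n m) → Prop
  | root : Reach g₀ g₀ .nvar .svar
  | exN {k l : ℕ} {g : Prenex L (k + 1) l} {s : Fin k → HTm L .num n m}
      {S : Fin l → HTm L .str n m} (h : Reach g₀ (.exN g) s S) (u : HTm L .num n m) :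
      Reach g₀ g (s ▹ u) S
  | exS {k l : ℕ} {g : Prenex L k (l + 1)} {s : Fin k → HTm L .num n m}
      {S : Fin l → HTm L .str n m} (h : Reach g₀ (.exS g) s S) (u : HTm L .str n m) :
      Reach g₀ g s (S ▹ u)
  | gt {k l : ℕ} {t : BTm k l} {g : Prenex L (k + 1) l} {s : Fin k → HTm L .num n m}
      {S : Fin l → HTm L .str n m} (h : Reach g₀ (.ball t g) s S) :
      Reach g₀ (.qf (.neg (.le (.nvar (Fin.last k)) t.toTm.liftN))) (s ▹ .fn (.cex t g) s S) S
  | ball {k l : ℕ} {t : BTm k l} {g : Prenex L (k + 1) l} {s : Fin k → HTm L .num n m}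
      {S : Fin l → HTm L .str n m} (h : Reach g₀ (.ball t g) s S) :
      Reach g₀ g (s ▹ .fn (.cex t g) s S) S

/-- Admissible assignments of names to the number variables of a context: each variable after the
first `n` is named by a symbol for a counterexample applied to terms that have names already. -/
inductive Adm {n m : ℕ} : {N : ℕ} → (Fin N → HTm L .num n m) → Prop
  | init : Adm .nvar
  | snoc {N : ℕ} {ρ : Fin N → HTm L .num n m} (h : Adm ρ) {k l : ℕ} (t : BTm k l)
      (g : Prenex L (k + 1) l) (s : Fin k → L.Term .num N m) (S : Fin l → L.Term .str N m)
      (hn : ∀ i, ρ i ≠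
        .fn (.cex t g) (fun i => nameTm (s i) ρ .svar) (fun j => nameTm (S j) ρ .svar)) :
      Adm (ρ ▹ .fn (.cex t g) (fun i => nameTm (s i) ρ .svar) (fun j => nameTm (S j) ρ .svar))

variable {n m : ℕ}

theorem Adm.isAtom {N : ℕ} {ρ : Fin N → HTm L .num n m} (h : Adm ρ) : ∀ i, IsAtom (ρ i) := by
  induction h with
  | init => exact fun i => .inl ⟨i, rfl⟩
  | snoc h t g s S hn ih =>
    intro i
    induction i using Fin.lastCases with
    | last => exact .inr ⟨_, _, t, g, _, _, Fin.snoc_last _ _⟩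
    | cast i => simpa using ih i

theorem Adm.injective {N : ℕ} {ρ : Fin N → HTm L .num n m} (h : Adm ρ) :
    Function.Injective ρ := by
  induction h with
  | init => exact fun i j e => by simpa using e
  | snoc h t g s S hn ih =>
    intro i j e
    induction i using Fin.lastCases <;> induction j using Fin.lastCases
    · rfl
    · exact absurd (by simpa using e.symm) (hn _)
    · exact absurd (by simpa using e) (hn _)
    · exact congrArg _ (ih (by simpa using e))

theorem Adm.nameTm_injective {N : ℕ} {ρ : Fin N → HTm L .num n m} (h : Adm ρ) {c : Srt}
    {t t' : L.Term c N m} (e : nameTm t ρ .svar = nameTm t' ρ .svar) : t = t' :=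
  TwoSorted.nameTm_injective h.isAtom h.injective t t' e

theorem Adm.exists_var {N : ℕ} {ρ : Fin N → HTm L .num n m} (h : Adm ρ) (j : Fin n) :
    ∃ i, ρ i = .nvar j := by
  induction h with
  | init => exact ⟨j, rfl⟩
  | snoc h t g s S hn ih =>
    obtain ⟨i, hi⟩ := ih
    exact ⟨i.castSucc, by simpa using hi⟩

theorem Adm.exists_args {N : ℕ} {ρ : Fin N → HTm L .num n m} (h : Adm ρ) {i : Fin N} {k l : ℕ}
    {t : BTm k l} {g : Prenex L (k + 1) l} {s : Fin k → HTm L .num n m}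
    {S : Fin l → HTm L .str n m} (e : ρ i = .fn (.cex t g) s S) :
    ∃ (s' : Fin k → L.Term .num N m) (S' : Fin l → L.Term .str N m),
      (fun i => nameTm (s' i) ρ .svar) = s ∧ (fun j => nameTm (S' j) ρ .svar) = S := by
  induction h with
  | init => simp at e
  | snoc h t' g' s' S' hn ih =>
    induction i using Fin.lastCases with
    | last =>
      simp only [Fin.snoc_last, Tm.fn.injEq] at e
      obtain ⟨rfl, rfl, -, hs, hS⟩ := e
      obtain rfl := eq_of_heq hs
      obtain rfl := eq_of_heq hS
      exact ⟨fun i => (s' i).liftN, fun j => (S' j).liftN, by simp [nameTm_liftN],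
        by simp [nameTm_liftN]⟩
    | cast i =>
      obtain ⟨s₀, S₀, rfl, rfl⟩ := ih (by simpa using e)
      exact ⟨fun i => (s₀ i).liftN, fun j => (S₀ j).liftN, by simp [nameTm_liftN],
        by simp [nameTm_liftN]⟩

/-- The term has a name in the context. -/
def Nameable {N : ℕ} (ρ : Fin N → HTm L .num n m) {c : Srt} (h : HTm L c n m) : Prop :=
  ∃ t : L.Term c N m, nameTm t ρ .svar = h

/-- If each term of a finite family can be given a name by extending contexts, then all of them can
be given names together. -/
theorem exists_adm_family {c : Srt} {k : ℕ} (s : Fin k → HTm L c n m)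
    (hs : ∀ i, ∀ {N : ℕ} {ρ : Fin N → HTm L .num n m}, Adm ρ → ∃ (N' : ℕ)
      (ρ' : Fin N' → HTm L .num n m), Adm ρ' ∧
      (∀ {c : Srt} (h : HTm L c n m), Nameable ρ h → Nameable ρ' h) ∧ Nameable ρ' (s i))
    {N : ℕ} {ρ : Fin N → HTm L .num n m} (hρ : Adm ρ) :
    ∃ (N' : ℕ) (ρ' : Fin N' → HTm L .num n m), Adm ρ' ∧
      (∀ {c : Srt} (h : HTm L c n m), Nameable ρ h → Nameable ρ' h) ∧
      ∀ i, Nameable ρ' (s i) := by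
  induction k with
  | zero => exact ⟨N, ρ, hρ, fun _ h => h, fun i => i.elim0⟩
  | succ k ih =>
    obtain ⟨N₁, ρ₁, h₁, e₁, hs₁⟩ := ih (fun i => s i.castSucc) (fun i => hs i.castSucc)
    obtain ⟨N₂, ρ₂, h₂, e₂, hs₂⟩ := hs (Fin.last k) h₁
    refine ⟨N₂, ρ₂, h₂, fun h hh => e₂ h (e₁ h hh), fun i => ?_⟩
    induction i using Fin.lastCases with
    | last => exact hs₂
    | cast i => exact e₂ _ (hs₁ i)

/-- Every Herbrand term has a name in some extension of the context. -/
theorem Adm.exists_nameable {c : Srt} (h : HTm L c n m) :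
    ∀ {N : ℕ} {ρ : Fin N → HTm L .num n m}, Adm ρ → ∃ (N' : ℕ)
      (ρ' : Fin N' → HTm L .num n m), Adm ρ' ∧
      (∀ {c : Srt} (h : HTm L c n m), Nameable ρ h → Nameable ρ' h) ∧ Nameable ρ' h := by
  induction h with
  | nvar j =>
    intro N ρ hρ
    obtain ⟨i, hi⟩ := hρ.exists_var j
    exact ⟨N, ρ, hρ, fun _ h => h, .nvar i, hi⟩
  | svar j => exact fun {N ρ} hρ => ⟨N, ρ, hρ, fun _ h => h, .svar j, rfl⟩
  | zero => exact fun {N ρ} hρ => ⟨N, ρ, hρ, fun _ h => h, .zero, rfl⟩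
  | one => exact fun {N ρ} hρ => ⟨N, ρ, hρ, fun _ h => h, .one, rfl⟩
  | add s t ihs iht =>
    intro N ρ hρ
    obtain ⟨N₁, ρ₁, h₁, e₁, hs⟩ := ihs hρ
    obtain ⟨N₂, ρ₂, h₂, e₂, t', ht⟩ := iht h₁
    obtain ⟨s', hs⟩ := e₂ _ hs
    exact ⟨N₂, ρ₂, h₂, fun h hh => e₂ h (e₁ h hh), .add s' t', by simp [nameTm, hs, ht]⟩
  | mul s t ihs iht =>
    intro N ρ hρ
    obtain ⟨N₁, ρ₁, h₁, e₁, hs⟩ := ihs hρ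
    obtain ⟨N₂, ρ₂, h₂, e₂, t', ht⟩ := iht h₁
    obtain ⟨s', hs⟩ := e₂ _ hs
    exact ⟨N₂, ρ₂, h₂, fun h hh => e₂ h (e₁ h hh), .mul s' t', by simp [nameTm, hs, ht]⟩
  | len S ih =>
    intro N ρ hρ
    obtain ⟨N₁, ρ₁, h₁, e₁, S', hS⟩ := ih hρ
    exact ⟨N₁, ρ₁, h₁, e₁, .len S', by simp [nameTm, hS]⟩
  | fn f s S ihs ihS =>
    intro N ρ hρ
    obtain ⟨N₁, ρ₁, h₁, e₁, hs⟩ := exists_adm_family s (fun i => ihs i) hρ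
    obtain ⟨N₂, ρ₂, h₂, e₂, hS⟩ := exists_adm_family S (fun j => ihS j) h₁
    choose s' hs using fun i => e₂ _ (hs i)
    choose S' hS using hS
    obtain rfl := funext hs
    obtain rfl := funext hS
    have e : ∀ {c : Srt} (h : HTm L c _ _), Nameable ρ h → Nameable ρ₂ h :=
      fun h hh => e₂ h (e₁ h hh)
    cases f with
    | base f => exact ⟨N₂, ρ₂, h₂, e, .fn f s' S', rfl⟩
    | cex t g =>
      by_cases hn : ∀ i, ρ₂ i ≠
          .fn (.cex t g) (fun i => nameTm (s' i) ρ₂ .svar) (fun j => nameTm (S' j) ρ₂ .svar)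
      · exact ⟨N₂ + 1, _, h₂.snoc t g s' S' hn,
          fun h hh => let ⟨t, ht⟩ := e h hh; ⟨t.liftN, by rw [nameTm_liftN, ht]⟩,
          .nvar (Fin.last N₂), by simp [nameTm]⟩
      · push Not at hn
        obtain ⟨i, hi⟩ := hn
        exact ⟨N₂, ρ₂, h₂, e, .nvar i, hi⟩

/-- The instances from which all other nameable instances in `Reach g₀` arise by instantiation of
existential quantifiers only: `g₀` itself and those given by the named counterexamples. -/
inductive Src (g₀ : Prenex L n m) {N : ℕ} (ρ : Fin N → HTm L .num n m) : Inst L N m → Prop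
  | root (s : Fin n → L.Term .num N m) (S : Fin m → L.Term .str N m)
      (hs : ∀ j, nameTm (s j) ρ .svar = .nvar j) (hS : ∀ j, nameTm (S j) ρ .svar = .svar j) :
      Src g₀ ρ ⟨g₀, s, S⟩
  | gt {k l : ℕ} (t : BTm k l) (g : Prenex L (k + 1) l) (s : Fin k → L.Term .num N m)
      (S : Fin l → L.Term .str N m) (i : Fin N)
      (h : Reach g₀ (.ball t g) (fun i => nameTm (s i) ρ .svar) (fun j => nameTm (S j) ρ .svar))
      (hi : ρ i =
        .fn (.cex t g) (fun i => nameTm (s i) ρ .svar) (fun j => nameTm (S j) ρ .svar)) :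
      Src g₀ ρ (gtInst t s (.nvar i) S)
  | ball {k l : ℕ} (t : BTm k l) (g : Prenex L (k + 1) l) (s : Fin k → L.Term .num N m)
      (S : Fin l → L.Term .str N m) (i : Fin N)
      (h : Reach g₀ (.ball t g) (fun i => nameTm (s i) ρ .svar) (fun j => nameTm (S j) ρ .svar))
      (hi : ρ i =
        .fn (.cex t g) (fun i => nameTm (s i) ρ .svar) (fun j => nameTm (S j) ρ .svar)) :
      Src g₀ ρ ⟨g, s ▹ .nvar i, S⟩

variable {T : OpenTheory L} {g₀ : Prenex L n m}

/-- A witness for a nameable instance in `Reach g₀` leads to a witness for one of the instances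
`Src g₀ ρ` from which it arises. -/
theorem Reach.exists_src {N : ℕ} {ρ : Fin N → HTm L .num n m} {k l : ℕ}
    {g : Prenex L k l} {s' : Fin k → HTm L .num n m} {S' : Fin l → HTm L .str n m}
    (h : Reach g₀ g s' S') :
    ∀ (s : Fin k → L.Term .num N m) (S : Fin l → L.Term .str N m),
      (fun i => nameTm (s i) ρ .svar) = s' → (fun j => nameTm (S j) ρ .svar) = S' →
      ∀ δ, Inst.WitBy T ⟨g, s, S⟩ δ → ∃ I ∈ {I | Src g₀ ρ I}, I.WitBy T δ := by
  have hsnoc : ∀ {k : ℕ} {c : Srt} {s : Fin (k + 1) → L.Term c N m} {s' : Fin k → HTm L c n m}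
      {u : HTm L c n m}, (fun i => nameTm (s i) ρ .svar) = s' ▹ u →
      (fun i => nameTm (s (Fin.castSucc i)) ρ .svar) = s' ∧
        nameTm (s (Fin.last k)) ρ .svar = u := by
    intro k c s s' u h
    exact ⟨funext fun i => by simpa using congrFun h i.castSucc,
      by simpa using congrFun h (Fin.last k)⟩
  have heta : ∀ {A : Type u} {k : ℕ} (s : Fin (k + 1) → A),
      s = (fun i => s (Fin.castSucc i)) ▹ s (Fin.last k) := by
    intro A k s
    funext i
    induction i using Fin.lastCases <;> simp
  induction h with
  | root =>
    intro s S hs hS δ hW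
    exact ⟨_, .root s S (congrFun hs) (congrFun hS), hW⟩
  | exN h u ih =>
    intro s S hs hS δ hW
    obtain ⟨hs₁, hs₂⟩ := hsnoc hs
    refine ih (fun i => s i.castSucc) S hs₁ hS δ ⟨s (Fin.last _), Wit.anti ?_ hW⟩
    rintro M hM x X _ _ ⟨_, ⟨hδ, rfl, rfl⟩, rfl⟩
    exact ⟨hδ, (heta fun i => M.eval (s i) x X).symm, rfl⟩
  | exS h u ih =>
    intro s S hs hS δ hW
    obtain ⟨hS₁, hS₂⟩ := hsnoc hS
    refine ih s (fun i => S i.castSucc) hs hS₁ δ ⟨S (Fin.last _), Wit.anti ?_ hW⟩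
    rintro M hM x X _ _ ⟨_, ⟨hδ, rfl, rfl⟩, rfl⟩
    exact ⟨hδ, rfl, (heta fun i => M.eval (S i) x X).symm⟩
  | gt h ih =>
    intro s S hs hS δ hW
    obtain ⟨rfl, hs₂⟩ := hsnoc hs
    subst hS
    obtain ⟨i, hi, hi'⟩ := nameTm_eq_atom (.inr ⟨_, _, _, _, _, _, rfl⟩) hs₂
    refine ⟨_, .gt _ _ _ S i h hi', ?_⟩
    rw [heta s, hi] at hW
    exact hW
  | ball h ih =>
    intro s S hs hS δ hW
    obtain ⟨rfl, hs₂⟩ := hsnoc hs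
    subst hS
    obtain ⟨i, hi, hi'⟩ := nameTm_eq_atom (.inr ⟨_, _, _, _, _, _, rfl⟩) hs₂
    refine ⟨_, .ball _ _ _ S i h hi', ?_⟩
    rw [heta s, hi] at hW
    exact hW

theorem Inst.lift_snoc {N k l : ℕ} (g : Prenex L (k + 1) l) (s : Fin k → L.Term .num N m)
    (i : Fin N) (S : Fin l → L.Term .str N m) :
    Inst.lift ⟨g, s ▹ .nvar i, S⟩
      = ⟨g, (fun i => (s i).liftN) ▹ .nvar i.castSucc, fun j => (S j).liftN⟩ := by
  simp only [Inst.lift, Inst.mk.injEq, heq_eq_eq, true_and, and_true]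
  funext j
  induction j using Fin.lastCases <;> simp [Tm.liftN, Tm.subst]

theorem Adm.not_covered {ι : Inclusion LFAC L} {C : ClosedUnderDef L}
    (hT : ∀ M : Struc.{u, u} L, T.IsModel M → IsStd ι C M)
    (h₀ : ¬ Covered T {(⟨g₀, .nvar, .svar⟩ : Inst L n m)}) {N : ℕ}
    {ρ : Fin N → HTm L .num n m} (h : Adm ρ) : ¬ Covered T {I | Src g₀ ρ I} := by
  induction h with
  | init =>
    refine fun hc => h₀ (hc.mono ?_)
    rintro _ (⟨s, S, hs, hS⟩ | ⟨t, g, s, S, i, h, hi⟩ | ⟨t, g, s, S, i, h, hi⟩)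
    · obtain rfl : s = .nvar := funext fun j => Adm.init.nameTm_injective (hs j)
      obtain rfl : S = .svar := funext fun j => Adm.init.nameTm_injective (hS j)
      rfl
    · cases hi
    · cases hi
  | @snoc N ρ h k l t g s S hn ih =>
    have h' := h.snoc t g s S hn
    set H : HTm L .num n m :=
      .fn (.cex t g) (fun i => nameTm (s i) ρ .svar) (fun j => nameTm (S j) ρ .svar) with hH
    have hlift : ∀ {c : Srt} {k : ℕ} {s' : Fin k → L.Term c (N + 1) m}
        {s : Fin k → L.Term c N m},
        (fun i => nameTm (s' i) (ρ ▹ H) .svar) = (fun i => nameTm (s i) ρ .svar) →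
        s' = fun i => (s i).liftN := fun e => funext fun j => h'.nameTm_injective <| by
      rw [nameTm_liftN]; exact congrFun e j
    -- The arguments of a name do not contain the new variable.
    have hold : ∀ {k l : ℕ} {t : BTm k l} {g : Prenex L (k + 1) l} {i : Fin N}
        {s' : Fin k → L.Term .num (N + 1) m} {S' : Fin l → L.Term .str (N + 1) m},
        ρ i = .fn (.cex t g) (fun i => nameTm (s' i) (ρ ▹ H) .svar)
          (fun j => nameTm (S' j) (ρ ▹ H) .svar) →
        ∃ (s : Fin k → L.Term .num N m) (S : Fin l → L.Term .str N m),
          s' = (fun i => (s i).liftN) ∧ S' = (fun j => (S j).liftN) ∧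
          (fun i => nameTm (s' i) (ρ ▹ H) .svar) = (fun i => nameTm (s i) ρ .svar) ∧
          (fun i => nameTm (S' i) (ρ ▹ H) .svar) = (fun i => nameTm (S i) ρ .svar) := by
      intro k l t g i s' S' hi
      obtain ⟨s, S, hs, hS⟩ := h.exists_args hi
      exact ⟨s, S, hlift hs.symm, hlift hS.symm, hs.symm, hS.symm⟩
    have hsub : ∀ I, Src g₀ (ρ ▹ H) I → I ∈ Inst.lift '' {I | Src g₀ ρ I} ∨
        Reach g₀ (.ball t g) (fun i => nameTm (s i) ρ .svar) (fun j => nameTm (S j) ρ .svar) ∧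
        I ∈ ({gtInst t (fun i => (s i).liftN) (.nvar (Fin.last N)) (fun j => (S j).liftN),
          ⟨g, (fun i => (s i).liftN) ▹ .nvar (Fin.last N), fun j => (S j).liftN⟩} :
          Set (Inst L (N + 1) m)) := by
      rintro _ (⟨s', S', hs, hS⟩ | ⟨t', g', s', S', i, hr, hi⟩ | ⟨t', g', s', S', i, hr, hi⟩)
      · choose i hi using h.exists_var
        refine .inl ⟨_, .root (fun j => .nvar (i j)) .svar hi (fun _ => rfl), ?_⟩
        rw [hlift (s := fun j => .nvar (i j)) (funext fun j => (hs j).trans (hi j).symm),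
          hlift (s := .svar) (funext hS)]
        rfl
      · induction i using Fin.lastCases with
        | last =>
          rw [Fin.snoc_last, hH, Tm.fn.injEq] at hi
          obtain ⟨rfl, rfl, he, hs, hS⟩ := hi
          cases eq_of_heq he
          rw [← eq_of_heq hs, ← eq_of_heq hS] at hr
          rw [hlift (eq_of_heq hs).symm, hlift (eq_of_heq hS).symm]
          exact .inr ⟨hr, .inl rfl⟩
        | cast i =>
          rw [Fin.snoc_castSucc] at hi
          obtain ⟨s, S, rfl, rfl, hs, hS⟩ := hold hi
          rw [hs, hS] at hi hr
          exact .inl ⟨_, .gt t' g' s S i hr hi, Inst.lift_snoc _ _ _ _⟩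
      · induction i using Fin.lastCases with
        | last =>
          rw [Fin.snoc_last, hH, Tm.fn.injEq] at hi
          obtain ⟨rfl, rfl, he, hs, hS⟩ := hi
          cases eq_of_heq he
          rw [← eq_of_heq hs, ← eq_of_heq hS] at hr
          rw [hlift (eq_of_heq hs).symm, hlift (eq_of_heq hS).symm]
          exact .inr ⟨hr, .inr rfl⟩
        | cast i =>
          rw [Fin.snoc_castSucc] at hi
          obtain ⟨s, S, rfl, rfl, hs, hS⟩ := hold hi
          rw [hs, hS] at hi hr
          exact .inl ⟨_, .ball t' g' s S i hr hi, Inst.lift_snoc _ _ _ _⟩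
    intro hc
    by_cases hr : Reach g₀ (.ball t g) (fun i => nameTm (s i) ρ .svar)
        (fun j => nameTm (S j) ρ .svar)
    · exact ih (Covered.of_ball hT (hr.exists_src s S rfl rfl)
        (hc.mono fun I hI => (hsub I hI).imp_right And.right))
    · exact ih (hc.mono fun I hI => (hsub I hI).resolve_right fun h => hr h.1).of_lift

/-- The value that `x` gives to the variable named `h`, and `0` if there is none. -/
noncomputable def nameVal {M : Struc.{u, u} L} {N : ℕ} (ρ : Fin N → HTm L .num n m)
    (x : Fin N → M.Dom .num) (h : HTm L .num n m) : M.Dom .num :=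
  open Classical in if h' : ∃ i, ρ i = h then x h'.choose else M.zero

theorem Adm.hval_nameTm {M : Struc.{u, u} L} {N : ℕ} {ρ : Fin N → HTm L .num n m} (h : Adm ρ)
    (x : Fin N → M.Dom .num) (X : Fin m → M.Dom .str) {c : Srt} (t : L.Term c N m) :
    hval M (nameTm t ρ .svar) (nameVal ρ x) X = M.eval t x X := by
  have hv : ∀ i, nameVal ρ x (ρ i) = x i := by
    intro i
    have h' : ∃ j, ρ j = ρ i := ⟨i, rfl⟩
    rw [nameVal, dif_pos h', h.injective h'.choose_spec]
  have hx : ∀ i, hval M (ρ i) (nameVal ρ x) X = x i := by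
    intro i
    rw [← hv i]
    rcases h.isAtom i with ⟨j, e⟩ | ⟨k, l, t, g, s, S, e⟩ <;> rw [e] <;> rfl
  rw [TwoSorted.hval_nameTm]
  simp only [hx]
  rfl

/-- An instance of an open formula by Herbrand terms. -/
structure OpenInst (L : Vocab.{u}) (n m : ℕ) : Type u where
  {k l : ℕ}
  α : L.Open k l
  s : Fin k → HTm L .num n m
  S : Fin l → HTm L .str n m

theorem exists_adm_list (A : List (OpenInst L n m)) : ∃ (N : ℕ) (ρ : Fin N → HTm L .num n m),
    Adm ρ ∧ ∀ a ∈ A, (∀ i, Nameable ρ (a.s i)) ∧ ∀ j, Nameable ρ (a.S j) := by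
  induction A with
  | nil => exact ⟨n, .nvar, .init, by simp⟩
  | cons a A ih =>
    obtain ⟨N, ρ, hρ, h⟩ := ih
    obtain ⟨N₁, ρ₁, h₁, e₁, hs⟩ := exists_adm_family a.s
      (fun i => Adm.exists_nameable (a.s i)) hρ
    obtain ⟨N₂, ρ₂, h₂, e₂, hS⟩ := exists_adm_family a.S
      (fun i => Adm.exists_nameable (a.S i)) h₁
    refine ⟨N₂, ρ₂, h₂, fun b hb => ?_⟩
    rcases List.mem_cons.1 hb with rfl | hb
    · exact ⟨fun i => e₂ _ (hs i), hS⟩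
    · exact ⟨fun i => e₂ _ (e₁ _ ((h b hb).1 i)), fun j => e₂ _ (e₁ _ ((h b hb).2 j))⟩

/-- If `g₀` is not witnessed, then any finitely many open instances in `Reach g₀` are false in some
model of `T`. -/
theorem exists_model_finite {ι : Inclusion LFAC L} {C : ClosedUnderDef L}
    (hT : ∀ M : Struc.{u, u} L, T.IsModel M → IsStd ι C M)
    (h₀ : ¬ Covered T {(⟨g₀, .nvar, .svar⟩ : Inst L n m)}) (A : List (OpenInst L n m))
    (hA : ∀ a ∈ A, Reach g₀ (.qf a.α) a.s a.S) :
    ∃ M : Struc.{u, u} L, T.IsModel M ∧ ∃ v X, ∀ a ∈ A,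
      ¬ M.Sat a.α (fun i => hval M (a.s i) v X) (fun j => hval M (a.S j) v X) := by
  obtain ⟨N, ρ, hρ, hn⟩ := exists_adm_list A
  have : ∀ a : {a // a ∈ A}, ∃ (s : Fin a.1.k → L.Term .num N m)
      (S : Fin a.1.l → L.Term .str N m), (fun i => nameTm (s i) ρ .svar) = a.1.s ∧
        (fun j => nameTm (S j) ρ .svar) = a.1.S := by
    intro a
    choose s hs using (hn a.1 a.2).1
    choose S hS using (hn a.1 a.2).2
    exact ⟨s, S, funext hs, funext hS⟩
  choose s S hs hS using this
  obtain ⟨M, hM, x, X, h⟩ := exists_of_not_covered (hρ.not_covered hT h₀)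
    (ds := A.attach.map fun a => a.1.α.subst (s a) (S a)) (by
      intro δ hδ
      obtain ⟨a, -, rfl⟩ := List.mem_map.1 hδ
      exact (hA a.1 a.2).exists_src _ _ (hs a) (hS a) _ (Inst.witBy_qf _ _ _))
  refine ⟨M, hM, nameVal ρ x, X, fun a ha hsat => ?_⟩
  refine h _ (List.mem_map_of_mem (List.mem_attach A ⟨a, ha⟩)) ?_
  rw [M.sat_subst]
  rw [← hs ⟨a, ha⟩, ← hS ⟨a, ha⟩] at hsat
  simpa only [hρ.hval_nameTm] using hsat

end Herbrand

/-! ### The limit structure of Herbrand terms -/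

section Limit

variable {L : Vocab.{u}} {n m : ℕ}

/-- A family of structures in which the Herbrand terms have values has a limit along an ultrafilter,
a quotient of the set of Herbrand terms, in which the open formulas have the expected truth
values. -/
theorem exists_limit {I : Type u} (U : Ultrafilter I) (M : I → Struc.{u, u} L)
    (v : ∀ i, HTm L .num n m → (M i).Dom .num) (X : ∀ i, Fin m → (M i).Dom .str)
    (hne : Nonempty (L.Term .str n m)) :
    ∃ (N : Struc.{u, u} L) (q : ∀ c, HTm L c n m → N.Dom c), (∀ c, Function.Surjective (q c)) ∧
      ∀ {k l : ℕ} (α : L.Open k l) (s : Fin k → HTm L .num n m) (S : Fin l → HTm L .str n m),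
        N.Sat α (fun i => q _ (s i)) (fun j => q _ (S j)) ↔
          ∀ᶠ a in U, (M a).Sat α (fun i => hval (M a) (s i) (v a) (X a))
            (fun j => hval (M a) (S j) (v a) (X a)) := by
  let ev : ∀ a {c : Srt}, HTm L c n m → (M a).Dom c := fun a c h => hval (M a) h (v a) (X a)
  let r : ∀ c, Setoid (HTm L c n m) := fun c =>
    { r := fun h h' => ∀ᶠ a in U, ev a h = ev a h'
      iseqv := ⟨fun _ => .of_forall fun _ => rfl, fun h => h.mono fun _ h => h.symm,
        fun h h' => (h.and h').mono fun _ h => h.1.trans h.2⟩ }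
  let N : Struc.{u, u} L :=
    { Dom := fun c => Quotient (r c)
      dom_nonempty := fun c => match c with
        | .num => ⟨Quotient.mk _ .zero⟩
        | .str => hne.map fun t => Quotient.mk _ (nameTm t .nvar .svar)
      zero := Quotient.mk _ .zero
      one := Quotient.mk _ .one
      add := fun a b => Quotient.mk _ (.add a.out b.out)
      mul := fun a b => Quotient.mk _ (.mul a.out b.out)
      len := fun A => Quotient.mk _ (.len A.out)
      le := fun a b => ∀ᶠ i in U, (M i).le (ev i a.out) (ev i b.out)
      mem := fun a A => ∀ᶠ i in U, (M i).mem (ev i a.out) (ev i A.out)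
      fn := fun f s S =>
        Quotient.mk _ (.fn (.base f) (fun i => (s i).out) (fun j => (S j).out))
      rel := fun R s S => ∀ᶠ a in U, (M a).rel R (fun i => ev a (s i).out)
        (fun j => ev a (S j).out) }
  let q : ∀ c, HTm L c n m → N.Dom c := fun c h => Quotient.mk (r c) h
  have hout : ∀ {c : Srt} (h : HTm L c n m),
      ∀ᶠ a in U, ev a (Quotient.out (s := r c) (q c h)) = ev a h :=
    fun {c} h => Quotient.exact (s := r c) (Quotient.out_eq (s := r c) (q c h))
  have hqeq : ∀ {c : Srt} {h h' : HTm L c n m}, q c h = q c h' ↔ ∀ᶠ a in U, ev a h = ev a h' :=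
    fun {c} h h' => Quotient.eq (r := r c)
  have heval : ∀ {c : Srt} {k l : ℕ} (t : L.Term c k l) (s : Fin k → HTm L .num n m)
      (S : Fin l → HTm L .str n m),
      N.eval t (fun i => q _ (s i)) (fun j => q _ (S j)) = q _ (nameTm t s S) := by
    intro c k l t s S
    induction t with
    | nvar i => rfl
    | svar j => rfl
    | zero => rfl
    | one => rfl
    | add t t' ih ih' =>
      rw [Struc.eval, ih, ih']
      refine hqeq.2 (((hout (nameTm t s S)).and (hout (nameTm t' s S))).mono fun a h => ?_)
      exact congrArg₂ (M a).add h.1 h.2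
    | mul t t' ih ih' =>
      rw [Struc.eval, ih, ih']
      refine hqeq.2 (((hout (nameTm t s S)).and (hout (nameTm t' s S))).mono fun a h => ?_)
      exact congrArg₂ (M a).mul h.1 h.2
    | len T ih =>
      rw [Struc.eval, ih]
      exact hqeq.2 ((hout (nameTm T s S)).mono fun a h => congrArg (M a).len h)
    | fn f t T iht ihT =>
      rw [Struc.eval]
      simp only [iht, ihT]
      refine hqeq.2 (((Filter.eventually_all.2 fun i => hout (nameTm (t i) s S)).and
        (Filter.eventually_all.2 fun j => hout (nameTm (T j) s S))).mono fun a h => ?_)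
      exact congrArg₂ ((M a).fn f) (funext h.1) (funext h.2)
  refine ⟨N, q, fun c => Quotient.mk_surjective, fun {k l} α s S => ?_⟩
  have hev : ∀ {c : Srt} (t : L.Term c k l) a, ev a (nameTm t s S)
      = (M a).eval t (fun i => ev a (s i)) (fun j => ev a (S j)) :=
    fun t a => hval_nameTm (M a) t s S (v a) (X a)
  change _ ↔ ∀ᶠ a in U, (M a).Sat α (fun i => ev a (s i)) (fun j => ev a (S j))
  suffices h : ∀ {κ : Kind} (α : Fm L.Fn L.Rel κ k l), κ = .qf →
      (N.Sat α (fun i => q _ (s i)) (fun j => q _ (S j)) ↔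
        ∀ᶠ a in U, (M a).Sat α (fun i => ev a (s i)) (fun j => ev a (S j))) from h α rfl
  clear α
  intro κ α hκ
  induction α with
  | tru => simp [Struc.Sat]
  | fls => simp [Struc.Sat, U.neBot.ne]
  | eqN t t' => simp only [Struc.Sat, heval, hqeq, hev]
  | eqS t t' => simp only [Struc.Sat, heval, hqeq, hev]
  | le t t' =>
    simp only [Struc.Sat, heval]
    refine Filter.eventually_congr
      (((hout (nameTm t s S)).and (hout (nameTm t' s S))).mono fun a h => ?_)
    rw [h.1, h.2, hev, hev]
  | mem t T =>
    simp only [Struc.Sat, heval]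
    refine Filter.eventually_congr
      (((hout (nameTm t s S)).and (hout (nameTm T s S))).mono fun a h => ?_)
    rw [h.1, h.2, hev, hev]
  | rel R t T =>
    simp only [Struc.Sat, heval]
    refine Filter.eventually_congr (((Filter.eventually_all.2 fun i => hout (nameTm (t i) s S)).and
        (Filter.eventually_all.2 fun j => hout (nameTm (T j) s S))).mono fun a h => ?_)
    simp only [h.1, h.2, hev]
  | neg α ih => simp only [Struc.Sat, Ultrafilter.eventually_not, ih s S hev hκ]
  | and α β ih ih' => simp only [Struc.Sat, Filter.eventually_and, ih s S hev hκ, ih' s S hev hκ]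
  | or α β ih ih' => simp only [Struc.Sat, Ultrafilter.eventually_or, ih s S hev hκ, ih' s S hev hκ]
  | _ => cases hκ

/-- A prenex formula that is true in all models of `T` is witnessed by terms.  Otherwise the
instances in `Reach g₀` can be made false simultaneously in a limit structure: it is a model of `T`
since the axioms of `T` are open, and it falsifies `g₀` since each of its elements is the value of a
Herbrand term. -/
theorem Prenex.exists_wit {T : OpenTheory L} {ι : Inclusion LFAC L} {C : ClosedUnderDef L}
    (hT : ∀ M : Struc.{u, u} L, T.IsModel M → IsStd ι C M) {g₀ : Prenex L n m}
    (h : ∀ M : Struc.{u, u} L, T.IsModel M → ∀ x X, g₀.Sat M x X) :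
    Wit T g₀ (N := n) (m := m) fun _ x X s S => s = x ∧ S = X := by
  classical
  refine Covered.wit hT (by_contra fun h₀ => ?_)
  have hfin : ∀ A : Finset (OpenInst L n m), ∃ M : Struc.{u, u} L, T.IsModel M ∧ ∃ v X,
      ∀ a ∈ A, Reach g₀ (.qf a.α) a.s a.S →
        ¬ M.Sat a.α (fun i => hval M (a.s i) v X) (fun j => hval M (a.S j) v X) := by
    intro A
    obtain ⟨M, hM, v, X, h⟩ := exists_model_finite hT h₀
      (A.filter fun a => Reach g₀ (.qf a.α) a.s a.S).toList (by simp)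
    exact ⟨M, hM, v, X, fun a ha hr => h a (by simp [ha, hr])⟩
  choose M hM v X hfalse using hfin
  obtain ⟨N, q, hq, hN⟩ := exists_limit (Ultrafilter.of Filter.atTop) M v X
    ⟨appVars (C.F .tru .zero)⟩
  have hlift : ∀ {c : Srt} {k : ℕ} (x : Fin k → N.Dom c),
      ∃ s : Fin k → HTm L c n m, x = fun i => q c (s i) :=
    fun x => ⟨fun i => (hq _ (x i)).choose, funext fun i => (hq _ (x i)).choose_spec.symm⟩
  have hsnoc : ∀ {c : Srt} {k : ℕ} (s : Fin k → HTm L c n m) (u : HTm L c n m),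
      (fun i => q c (s i)) ▹ q c u = fun i => q c ((s ▹ u) i) := by
    intro c k s u
    funext i
    induction i using Fin.lastCases <;> simp
  have hNT : T.IsModel N := by
    intro k l α hα x Y
    obtain ⟨s, rfl⟩ := hlift x
    obtain ⟨S, rfl⟩ := hlift Y
    exact (hN α s S).2 (.of_forall fun A => hM A k l α hα _ _)
  have hqf : ∀ {k l : ℕ} {α : L.Open k l} {s S}, Reach g₀ (.qf α) s S →
      ¬ N.Sat α (fun i => q _ (s i)) (fun j => q _ (S j)) := by
    intro k l α s S hr
    rw [hN, ← Ultrafilter.eventually_not]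
    refine Ultrafilter.of_le _ ((Filter.eventually_ge_atTop {⟨α, s, S⟩}).mono fun A hA => ?_)
    exact hfalse A ⟨α, s, S⟩ (hA (by simp)) hr
  have hr : ∀ {k l : ℕ} (g : Prenex L k l) {s S}, Reach g₀ g s S →
      ¬ g.Sat N (fun i => q _ (s i)) (fun j => q _ (S j)) := by
    intro k l g
    induction g with
    | qf α => exact fun hr => hqf hr
    | exN g ih =>
      rintro s S hr ⟨a, ha⟩
      obtain ⟨u, rfl⟩ := hq _ a
      rw [hsnoc] at ha
      exact ih (hr.exN u) ha
    | exS g ih =>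
      rintro s S hr ⟨a, ha⟩
      obtain ⟨u, rfl⟩ := hq _ a
      rw [hsnoc] at ha
      exact ih (hr.exS u) ha
    | ball t g ih =>
      intro s S hr hs
      refine ih hr.ball ?_
      rw [← hsnoc]
      refine hs _ (by_contra fun hle => hqf hr.gt ?_)
      rw [← hsnoc]
      simpa [Struc.Sat, Struc.eval_liftN, Struc.eval] using hle
  exact hr g₀ .root (h N hNT _ _)

end Limit

/-! ### Polynomial bounds -/

section Bounds

variable {L : Vocab.{u}}

/-- The measure that polynomial bounds refer to: a number itself, and the length of a string. -/
def Struc.size (M : Struc.{u, u} L) : {c : Srt} → M.Dom c → M.Dom .num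
  | .num, a => a
  | .str, A => M.len A

/-- Base terms are monotone, so bounds on the arguments may be substituted into them; a bound on
the length of a string replaces that length. -/
theorem BTm.exists_comp {k l n m : ℕ} (p : BTm k l) (q : Fin k → BTm n m) (r : Fin l → BTm n m) :
    ∃ p' : BTm n m, ∀ (ι : Inclusion LFAC L) (C : ClosedUnderDef L) (M : Struc.{u, u} L),
      IsStd ι C M → ∀ s S x X, (∀ i, M.le (s i) (M.bval (q i) x X)) →
        (∀ j, M.le (M.len (S j)) (M.bval (r j) x X)) → M.le (M.bval p s S) (M.bval p' x X) := by
  induction p with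
  | var i => exact ⟨q i, fun ι C M _ s S x X h _ => h i⟩
  | zero => exact ⟨.zero, fun ι C M hM s S x X _ _ => hM.le_refl _⟩
  | one => exact ⟨.one, fun ι C M hM s S x X _ _ => hM.le_refl _⟩
  | add a b iha ihb =>
    obtain ⟨a', ha⟩ := iha
    obtain ⟨b', hb⟩ := ihb
    exact ⟨.add a' b', fun ι C M hM s S x X h h' =>
      hM.add_le_add' (ha ι C M hM s S x X h h') (hb ι C M hM s S x X h h')⟩
  | mul a b iha ihb =>
    obtain ⟨a', ha⟩ := iha
    obtain ⟨b', hb⟩ := ihb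
    exact ⟨.mul a' b', fun ι C M hM s S x X h h' =>
      hM.mul_le_mul' (ha ι C M hM s S x X h h') (hb ι C M hM s S x X h h')⟩
  | len j => exact ⟨r j, fun ι C M _ s S x X _ h => h j⟩

variable {T : OpenTheory L} {ι : Inclusion LFAC L} {C : ClosedUnderDef L}

theorem OpenTheory.PBounded.exists_bound (hb : T.PBounded)
    (hT : ∀ M : Struc.{u, u} L, T.IsModel M → IsStd ι C M) {c : Srt} {n m : ℕ}
    (t : L.Term c n m) : ∃ p : BTm n m, ∀ M : Struc.{u, u} L, T.IsModel M →
      ∀ x X, M.le (M.size (M.eval t x X)) (M.bval p x X) := by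
  induction t with
  | nvar i => exact ⟨.var i, fun M hM x X => (hT M hM).le_refl _⟩
  | svar j => exact ⟨.len j, fun M hM x X => (hT M hM).le_refl _⟩
  | zero => exact ⟨.zero, fun M hM x X => (hT M hM).le_refl _⟩
  | one => exact ⟨.one, fun M hM x X => (hT M hM).le_refl _⟩
  | add s t ihs iht =>
    obtain ⟨p, hp⟩ := ihs
    obtain ⟨q, hq⟩ := iht
    exact ⟨.add p q, fun M hM x X => (hT M hM).add_le_add' (hp M hM x X) (hq M hM x X)⟩
  | mul s t ihs iht =>
    obtain ⟨p, hp⟩ := ihs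
    obtain ⟨q, hq⟩ := iht
    exact ⟨.mul p q, fun M hM x X => (hT M hM).mul_le_mul' (hp M hM x X) (hq M hM x X)⟩
  | len S ih =>
    obtain ⟨p, hp⟩ := ih
    exact ⟨p, hp⟩
  | @fn c n m k l f s S ihs ihS =>
    choose q hq using ihs
    choose r hr using ihS
    obtain ⟨p, hp⟩ : ∃ p : BTm k l, ∀ M : Struc.{u, u} L, T.IsModel M →
        ∀ x X, M.le (M.size (M.fn f x X)) (M.bval p x X) := by
      cases c with
      | num =>
        obtain ⟨p, hp⟩ := hb.1 k l f
        exact ⟨p, fun M hM x X => (hp M hM x X).1⟩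
      | str =>
        obtain ⟨p, hp⟩ := hb.2 k l f
        exact ⟨p, fun M hM x X => (hp M hM x X).1⟩
    obtain ⟨p', hp'⟩ := p.exists_comp (L := L) q r
    exact ⟨p', fun M hM x X => (hT M hM).le_trans (hp M hM _ _)
      (hp' ι C M (hT M hM) _ _ x X (fun i => hq i M hM x X) (fun j => hr j M hM x X))⟩

/-- If all functions are polynomially bounded, then a string term `S` defines the same function as
the symbol `F_{α,t}` with `α ≡ z ∈ S` and `t` a bound on `|S|`. -/
theorem OpenTheory.PBounded.exists_fn (hb : T.PBounded)
    (hT : ∀ M : Struc.{u, u} L, T.IsModel M → IsStd ι C M) {n m : ℕ} (S : L.Term .str n m) :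
    ∃ F : L.Fn .str n m, ∀ M : Struc.{u, u} L, T.IsModel M →
      ∀ x X, M.fn F x X = M.eval S x X := by
  obtain ⟨p, hp⟩ := hb.exists_bound hT S
  refine ⟨C.F (.mem (.nvar (Fin.last n)) S.liftN) p, fun M hM x X =>
    (hT M hM).str_ext fun z => ?_⟩
  rw [(hT M hM).mem_F]
  simp only [Struc.Sat, Struc.eval, Struc.eval_liftN, Fin.snoc_last, and_iff_right_iff_imp]
  exact fun hz => (hT M hM).lt_of_lt_of_le ((hT M hM).lt_len_of_mem hz) (hp M hM x X)

end Bounds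

/-! ### Witnesses for the leading block of string quantifiers -/

section Block

variable {L : Vocab.{u}} {T : OpenTheory L}

theorem Wit.exists_block {N m k l : ℕ} (p : ℕ) {E : EnvRel L N m k l} :
    ∀ g : Prenex L k (l + p), Wit T (Prenex.exSs p g) E → ∃ S : Fin p → L.Term .str N m,
      Wit T g (N := N) fun M x X s Z =>
        ∃ Y, E M x X s Y ∧ Z = Fin.append Y (fun i => M.eval (S i) x X) := by
  induction p with
  | zero =>
    intro g h
    refine ⟨fun i => i.elim0, Wit.anti ?_ h⟩
    rintro M hM x X s _ ⟨Y, hE, rfl⟩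
    convert hE using 1
    funext j
    exact Fin.append_left Y _ j
  | succ p ih =>
    intro g h
    obtain ⟨S, U, hW⟩ := ih (.exS g) h
    refine ⟨S ▹ U, Wit.anti ?_ hW⟩
    rintro M hM x X s _ ⟨Y, hE, rfl⟩
    refine ⟨_, ⟨Y, hE, rfl⟩, ?_⟩
    rw [M.eval_snoc]
    exact Fin.append_snoc _ _ _

theorem Struc.sat_substLast (M : Struc.{u, u} L) {n m p : ℕ} (φ : L.Formula n (m + p))
    (S : Fin p → L.Term .str n m) (x : Fin n → M.Dom .num) (X : Fin m → M.Dom .str) :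
    M.Sat (φ.substLast S) x X ↔ M.Sat φ x (Fin.append X fun i => M.eval (S i) x X) := by
  have h : (fun j => M.eval (Fin.append (fun j => .svar j) S j) x X)
      = Fin.append X fun i => M.eval (S i) x X := by
    funext j
    induction j using Fin.addCases <;> simp [Struc.eval]
  rw [Fm.substLast, Struc.sat_subst, h]
  rfl

end Block

end TwoSorted

open TwoSorted
theorem theoremt (L : Vocab.{u}) (ι : Inclusion LFAC L) (C : ClosedUnderDef L)
    (T : OpenTheory L) (hV : T.ExtendsVbar ι) (hC : T.HasDefAxioms C)
    (n m p : ℕ) (φ : L.Formula n (m + p)) (hφ : IsGSigma1B φ)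
    (h : T.Proves (Fm.exSs p φ)) :
    (∃ S : Fin p → L.Term .str n m, T.Proves (φ.substLast S)) ∧
    (T.PBounded →
      ∃ F : Fin p → L.Fn .str n m, T.Proves (φ.substLast fun i => appVars (F i))) := by
  have hT : ∀ M : Struc.{u, u} L, T.IsModel M → IsStd ι C M :=
    fun M hM => isStd_of_isModel hV hC hM
  obtain ⟨g, hg⟩ := hφ.exists_prenex C
  obtain ⟨S, hS⟩ := Wit.exists_block p g <| Prenex.exists_wit hT fun M hM x X =>
    (Prenex.sat_exSs p φ g (hg ι M (hT M hM)) x X).1 (h M hM x X)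
  have hφS : T.Proves (φ.substLast S) := fun M hM x X =>
    (M.sat_substLast φ S x X).2
      ((hg ι M (hT M hM) _ _).2 (hS.sound M hM x X x _ ⟨X, ⟨rfl, rfl⟩, rfl⟩))
  refine ⟨⟨S, hφS⟩, fun hb => ?_⟩
  choose F hF using fun i => hb.exists_fn hT (S i)
  refine ⟨F, fun M hM x X => (M.sat_substLast φ _ x X).2 ?_⟩
  have e : (fun i => M.eval (appVars (F i)) x X) = fun i => M.eval (S i) x X :=
    funext fun i => hF i M hM x X
  rw [e]
  exact (M.sat_substLast φ S x X).1 (hφS M hM x X)
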